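/- **Setting.** There are $U\ge 1$ users, $K\ge 1$ arms and $T\ge\max\{U,K\}$ rounds. The learner knows $U,K,T$, the arm costs $c_k\ge 0$ and a budget $B\in\mathbb N$ with $c_k\le B$ for all $k$. A matching $\pi:[U]\to[K]$ is feasible if $\sum_{k\in\mathrm{Im}(\pi)}c_k\le B$; $\Pi$ is the set of feasible matchings. For each user-arm pair there is an unknown, otherwise arbitrary reward distribution $D_{u,k}$ supported on $[0,1]$, with mean $\theta_{u,k}$. In round $t$ a (possibly randomized) learner chooses $\pi_t\in\Pi$ on the basis of the past matchings and observed rewards; then, independently over users and of the past, rewards $r^t_{u}\sim D_{u,\pi_t(u)}$ are drawn and observed for all users $u$. With $V(\pi;\Theta)=\sum_u\theta_{u,\pi(u)}$, the regret is $$R_T=T\max_{\pi\in\Pi}V(\pi;\Theta)-\mathbb E\Big[\sum_{t=1}^T\sum_{u}r^t_{u}\Big].$$ **Algorithm (CUCB).** In each round, let $n_{u,k}$ be the number of past rounds in which $u$ was matched to $k$ and $\bar\theta_{u,k}$ the average of the rewards observed in them, and put $P_{u,k}=\bar\theta_{u,k}+\sqrt{2\ln T/n_{u,k}}$ if $n_{u,k}>0$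 and $P_{u,k}=\infty$ otherwise. Play some $\pi\in\Pi$ that maximizes $V(\pi;P)=\sum_u P_{u,\pi(u)}$ over $\Pi$, where matchings of infinite value are compared by their number of infinite terms; remaining ties may be broken arbitrarily. (No bound on the running time is claimed.) **Statement.** 1. There is a universal constant $C>0$ such that, for all $U,K,T$, costs and budget as above, the algorithm can be implemented, and every implementation of it satisfies, for all reward distributions $(D_{u,k})$, $$R_T\le C\,U\sqrt{KT\ln T}.$$ 2. This is optimal up to logarithmic factors: there is a universal constant $c>0$ such that for all $U\ge1$, $K\ge2$ and $T\ge\max\{U,K\}$ there are costs and a budget as above for which every learner, computationally efficient or not, has regret $R_T\ge c\,U\sqrt{KT}$ for some choice of the reward distributions $(D_{u,k})$. -/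

import Mathlib

open MeasureTheory ProbabilityTheory
open scoped ENNReal NNReal

/-- A matching assigns one of the `K` arms to each of the `U` users. -/
abbrev Matching (U K : ℕ) : Type := Fin U → Fin K

/-- What the learner sees in one round (semi-bandit feedback): the chosen matching and, for each
user, the reward of that user's assigned arm. -/
abbrev Round (U K : ℕ) : Type := Matching U K × (Fin U → ℝ)

/-- The history of the first `t` rounds. -/
abbrev History (U K t : ℕ) : Type := Fin t → Round U K

/-- The known budget constraint of an instance: arm costs and a budget, where every single arm is
affordable. -/
structure BudgetConstraint (K : ℕ) where
  cost : Fin K → ℝ≥0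
  budget : ℕ
  cost_le : ∀ k, cost k ≤ budget

/-- A matching is feasible if the total cost of the arms in its image is within the budget. -/
def BudgetConstraint.Feasible {U K : ℕ} (b : BudgetConstraint K) (π : Matching U K) : Prop :=
  ∑ k ∈ Finset.univ.image π, b.cost k ≤ b.budget

/-- The unknown reward distributions `D u k`, supported on `[0, 1]`. -/
structure RewardModel (U K : ℕ) where
  D : Fin U → Fin K → Measure ℝ
  isProb : ∀ u k, IsProbabilityMeasure (D u k)
  support : ∀ u k, ∀ᵐ x ∂(D u k), x ∈ Set.Icc (0 : ℝ) 1

attribute [instance] RewardModel.isProb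

/-- The expected reward `θ u k`. -/
noncomputable def RewardModel.mean {U K : ℕ} (D : RewardModel U K) (u : Fin U) (k : Fin K) : ℝ :=
  ∫ x, x ∂(D.D u k)

/-- Total expected reward `V(π; Θ)` of a matching. -/
noncomputable def RewardModel.value {U K : ℕ} (D : RewardModel U K) (π : Matching U K) : ℝ :=
  ∑ u, D.mean u (π u)

/-- The value of the best feasible matching. -/
noncomputable def RewardModel.optValue {U K : ℕ} (D : RewardModel U K)
    (b : BudgetConstraint K) : ℝ :=
  ⨆ π : {π : Matching U K // b.Feasible π}, D.value π.1

/-- Given the matching `π`, the observed rewards are independent over the users, the reward of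
user `u` having law `D u (π u)`. -/
noncomputable def RewardModel.rewardKernel {U K : ℕ} (D : RewardModel U K) :
    Kernel (Matching U K) (Fin U → ℝ) where
  toFun π := Measure.pi fun u => D.D u (π u)
  measurable' := measurable_of_countable _

instance {U K : ℕ} (D : RewardModel U K) : IsMarkovKernel D.rewardKernel :=
  ⟨fun π => by
    change IsProbabilityMeasure (Measure.pi fun u => D.D u (π u))
    infer_instance⟩

/-- A (possibly randomized) learner: after each history, a law on feasible matchings.
It does not see the reward distributions. -/
structure Learner (U : ℕ) {K : ℕ} (b : BudgetConstraint K) where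
  policy : (t : ℕ) → Kernel (History U K t) (Matching U K)
  isMarkov : ∀ t, IsMarkovKernel (policy t)
  feasible : ∀ t h, ∀ᵐ π ∂(policy t h), b.Feasible π

attribute [instance] Learner.isMarkov

/-- One round of interaction: the learner draws a matching from its policy given the history, and
then the rewards are drawn given that matching, independently of the past. -/
noncomputable def roundKernel {U K : ℕ} {b : BudgetConstraint K} (A : Learner U b)
    (D : RewardModel U K) (t : ℕ) : Kernel (History U K t) (Round U K) :=
  A.policy t ⊗ₖ Kernel.prodMkLeft (History U K t) D.rewardKernel

instance {U K : ℕ} {b : BudgetConstraint K} (A : Learner U b) (D : RewardModel U K) (t : ℕ) :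
    IsMarkovKernel (roundKernel A D t) := by
  unfold roundKernel; infer_instance

/-- Append a round to a history. -/
def appendRound {U K t : ℕ} (p : History U K t × Round U K) : History U K (t + 1) :=
  Fin.snoc (α := fun _ => Round U K) p.1 p.2

/-- The law of the first `t` rounds when the learner `A` interacts with the rewards `D`. -/
noncomputable def historyLaw {U K : ℕ} {b : BudgetConstraint K} (A : Learner U b)
    (D : RewardModel U K) : (t : ℕ) → Measure (History U K t)
  | 0 => Measure.dirac Fin.elim0
  | t + 1 => ((historyLaw A D t) ⊗ₘ (roundKernel A D t)).map appendRound

theorem measurable_appendRound {U K t : ℕ} :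
    Measurable (appendRound : History U K t × Round U K → History U K (t + 1)) := by
  refine measurable_pi_lambda _ fun i => ?_
  induction i using Fin.lastCases with
  | last => simpa [appendRound] using measurable_snd
  | cast i =>
    simp only [appendRound, Fin.snoc_castSucc]
    exact (measurable_pi_apply i).comp measurable_fst

instance isProbabilityMeasure_historyLaw {U K : ℕ} {b : BudgetConstraint K} (A : Learner U b)
    (D : RewardModel U K) (t : ℕ) : IsProbabilityMeasure (historyLaw A D t) := by
  induction t with
  | zero => unfold historyLaw; infer_instance
  | succ t ih =>
    unfold historyLaw
    exact Measure.isProbabilityMeasure_map measurable_appendRound.aemeasurable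

/-- The expected regret over `T` rounds. -/
noncomputable def regret {U K : ℕ} {b : BudgetConstraint K} (T : ℕ) (A : Learner U b)
    (D : RewardModel U K) : ℝ :=
  T * D.optValue b - ∫ h, ∑ t, ∑ u, (h t).2 u ∂(historyLaw A D T)

/-- The number of past rounds in which user `u` was assigned arm `k`. -/
def pullCount {U K t : ℕ} (h : History U K t) (u : Fin U) (k : Fin K) : ℕ :=
  (Finset.univ.filter fun s => (h s).1 u = k).card

/-- The average of the rewards observed for the pair `(u, k)`. -/
noncomputable def empMean {U K t : ℕ} (h : History U K t) (u : Fin U) (k : Fin K) : ℝ :=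
  (∑ s ∈ Finset.univ.filter (fun s => (h s).1 u = k), (h s).2 u) / pullCount h u k

/-- The upper confidence index of the pair `(u, k)` for horizon `T`; it is `∞` for a pair that has
not been tried yet. -/
noncomputable def ucb {U K t : ℕ} (T : ℕ) (h : History U K t) (u : Fin U) (k : Fin K) : EReal :=
  if 0 < pullCount h u k then
    ((empMean h u k + Real.sqrt (2 * Real.log T / pullCount h u k) : ℝ) : EReal)
  else ⊤

/-- The optimistic value `V(π; P)` of a matching, `P` being the matrix of upper confidence
indices. -/
noncomputable def ucbValue {U K t : ℕ} (T : ℕ) (h : History U K t) (π : Matching U K) : EReal :=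
  ∑ u, ucb T h u (π u)

/-- The number of users that the matching assigns to an arm not yet tried for them, that is, the
number of infinite terms in `V(π; P)`. -/
def untriedCount {U K t : ℕ} (h : History U K t) (π : Matching U K) : ℕ :=
  (Finset.univ.filter fun u => pullCount h u (π u) = 0).card

/-- `π` maximizes `V(π; P)` over the feasible matchings, where matchings of infinite value are
compared by their number of infinite terms. All other ties are left open. -/
def IsOptimisticChoice {U K t : ℕ} (b : BudgetConstraint K) (T : ℕ) (h : History U K t)
    (π : Matching U K) : Prop :=
  b.Feasible π ∧
    (∀ π' : Matching U K, b.Feasible π' → ucbValue T h π' ≤ ucbValue T h π) ∧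
    (∀ π' : Matching U K, b.Feasible π' → untriedCount h π' ≤ untriedCount h π)

/-- `A` runs the combinatorial UCB algorithm with horizon `T`: in each of the `T` rounds it plays
an optimal matching for the current upper confidence indices. -/
def IsCUCB {U K : ℕ} {b : BudgetConstraint K} (T : ℕ) (A : Learner U b) : Prop :=
  ∀ t < T, ∀ h : History U K t, ∀ᵐ π ∂(A.policy t h), IsOptimisticChoice b T h π

/-! Upper bound. Three effects account for the regret. Exploration: each constant matching is
feasible, so an optimistic choice serves at least a fraction `1 / K` of the untried pairs. Their
number, initially `U * K ≤ T ^ 2`, thus shrinks geometrically and is zero after `2 * K * log T`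
rounds (`ae_untriedPairs_le`). Concentration: for a fixed exponent, Hoeffding's lemma makes the
exponential of the centred reward sum of a pair a supermartingale under any adaptive policy.
Markov's inequality and a union bound over pairs, pull counts and signs leave probability at most `2
/ T` for an inaccurate mean (`measure_badHistory_le`). Optimism: otherwise the loss is at most twice
the total confidence width of the matching played (`optValue_sub_value_le_width`). Each width is
paid for by the increase of `√n` in the potential `∑ √(pulls)`, which never exceeds `U * √(K * T)`
by Cauchy–Schwarz. If `T ≤ K * log T`, the trivial bound `T * U` suffices.

Lower bound. Without costs the users have separate bandit problems, although the learner may couple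
them. All rewards are fair coins, except that each user `u` has a hidden arm `κ u` with bias `e` of
order `√(K / T)`. If user `u` has no biased arm, the pull counts of `u` sum to `T`, so most arms are
pulled about `T / K` times. By an entropy estimate for the change of measure, biasing one such arm
hardly alters its expected pull count (`integral_pulls_le`). Averaged over `κ`, every user therefore
misses the hidden arm in at least a quarter of the rounds, at cost `e` each time. -/

/-! ### One round of interaction -/

/-- The joint law of the first `t` rounds and the following round. -/
noncomputable def stepLaw {U K : ℕ} {b : BudgetConstraint K} (A : Learner U b)
    (D : RewardModel U K) (t : ℕ) : Measure (History U K t × Round U K) :=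
  historyLaw A D t ⊗ₘ roundKernel A D t

section Step

variable {U K : ℕ} {b : BudgetConstraint K} (A : Learner U b) (D : RewardModel U K) (t : ℕ)

instance isProbabilityMeasure_stepLaw : IsProbabilityMeasure (stepLaw A D t) := by
  unfold stepLaw; infer_instance

theorem historyLaw_succ : historyLaw A D (t + 1) = (stepLaw A D t).map appendRound := rfl

theorem map_fst_stepLaw : (stepLaw A D t).map Prod.fst = historyLaw A D t :=
  Measure.fst_compProd _ _

theorem rewardKernel_apply (π : Matching U K) :
    D.rewardKernel π = Measure.pi fun u => D.D u (π u) := rfl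

theorem lintegral_stepLaw {F : History U K t × Round U K → ℝ≥0∞} (hF : Measurable F) :
    ∫⁻ p, F p ∂(stepLaw A D t) = ∫⁻ h, ∫⁻ π, ∫⁻ r, F (h, (π, r)) ∂(D.rewardKernel π)
      ∂(A.policy t h) ∂(historyLaw A D t) := by
  unfold stepLaw
  rw [Measure.lintegral_compProd hF]
  refine lintegral_congr fun h => ?_
  unfold roundKernel
  exact Kernel.lintegral_compProd _ _ _ (hF.comp measurable_prodMk_left)

theorem lintegral_historyLaw_succ {F : History U K (t + 1) → ℝ≥0∞} (hF : Measurable F) :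
    ∫⁻ h, F h ∂(historyLaw A D (t + 1)) =
      ∫⁻ h, ∫⁻ π, ∫⁻ r, F (appendRound (h, (π, r))) ∂(D.rewardKernel π)
      ∂(A.policy t h) ∂(historyLaw A D t) := by
  rw [historyLaw_succ, lintegral_map hF measurable_appendRound]
  exact lintegral_stepLaw A D t (hF.comp measurable_appendRound)

theorem ae_stepLaw_of_ae_ae {p : History U K t × Round U K → Prop}
    (hp : MeasurableSet {x | p x})
    (h : ∀ᵐ h ∂(historyLaw A D t), ∀ᵐ π ∂(A.policy t h), ∀ᵐ r ∂(D.rewardKernel π), p (h, (π, r))) :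
    ∀ᵐ x ∂(stepLaw A D t), p x := by
  refine Measure.ae_compProd_of_ae_ae hp ?_
  filter_upwards [h] with h hh
  exact Kernel.ae_compProd_of_ae_ae (hp.preimage measurable_prodMk_left) hh

theorem ae_stepLaw_fst {p : History U K t → Prop} (h : ∀ᵐ h ∂(historyLaw A D t), p h) :
    ∀ᵐ x ∂(stepLaw A D t), p x.1 := by
  rw [← map_fst_stepLaw] at h
  exact ae_of_ae_map measurable_fst.aemeasurable h

theorem ae_historyLaw_succ {p : History U K (t + 1) → Prop} (hp : MeasurableSet {x | p x})
    (h : ∀ᵐ x ∂(stepLaw A D t), p (appendRound x)) :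
    ∀ᵐ h ∂(historyLaw A D (t + 1)), p h := by
  rw [historyLaw_succ, ae_map_iff measurable_appendRound.aemeasurable hp]
  exact h

theorem integral_historyLaw_succ {F : History U K (t + 1) → ℝ} (hF : Measurable F) :
    ∫ h, F h ∂(historyLaw A D (t + 1)) = ∫ x, F (appendRound x) ∂(stepLaw A D t) := by
  rw [historyLaw_succ, integral_map measurable_appendRound.aemeasurable hF.aestronglyMeasurable]

theorem integral_stepLaw_fst {G : History U K t → ℝ} (hG : Measurable G) :
    ∫ x, G x.1 ∂(stepLaw A D t) = ∫ h, G h ∂(historyLaw A D t) := by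
  rw [← map_fst_stepLaw, integral_map measurable_fst.aemeasurable hG.aestronglyMeasurable]

theorem integrable_stepLaw_fst {G : History U K t → ℝ} (hG : Integrable G (historyLaw A D t)) :
    Integrable (fun x => G x.1) (stepLaw A D t) := by
  rw [← map_fst_stepLaw] at hG
  exact hG.comp_measurable measurable_fst

/-- Given the matching, the rewards of a round follow the reward kernel. -/
theorem map_snd_stepLaw : (stepLaw A D t).map Prod.snd =
    ((stepLaw A D t).map fun x => x.2.1) ⊗ₘ D.rewardKernel := by
  have hm : Measurable fun x : History U K t × Round U K => x.2.1 := by fun_prop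
  have : IsProbabilityMeasure ((stepLaw A D t).map fun x => x.2.1) :=
    Measure.isProbabilityMeasure_map hm.aemeasurable
  refine Measure.ext_of_lintegral _ fun f hf => ?_
  rw [lintegral_map hf measurable_snd, Measure.lintegral_compProd hf,
    lintegral_map (measurable_of_countable _) hm]
  refine (lintegral_stepLaw A D t (hf.comp measurable_snd)).trans
    (Eq.trans ?_ (lintegral_stepLaw A D t ((measurable_of_countable fun π : Matching U K =>
      ∫⁻ r, f (π, r) ∂(D.rewardKernel π)).comp hm)).symm)
  simp

theorem integral_stepLaw_round {φ : Round U K → ℝ} (hφ : Measurable φ)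
    (hi : Integrable (fun x => φ x.2) (stepLaw A D t)) :
    ∫ x, φ x.2 ∂(stepLaw A D t) =
      ∫ x, ∫ r, φ (x.2.1, r) ∂(D.rewardKernel x.2.1) ∂(stepLaw A D t) := by
  have hm : Measurable fun x : History U K t × Round U K => x.2.1 := by fun_prop
  have : IsProbabilityMeasure ((stepLaw A D t).map fun x => x.2.1) :=
    Measure.isProbabilityMeasure_map hm.aemeasurable
  have hi' : Integrable φ ((stepLaw A D t).map Prod.snd) :=
    (integrable_map_measure hφ.aestronglyMeasurable measurable_snd.aemeasurable).2 hi
  rw [← integral_map (φ := Prod.snd) measurable_snd.aemeasurable hφ.aestronglyMeasurable]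
  rw [map_snd_stepLaw] at hi' ⊢
  rw [Measure.integral_compProd hi',
    integral_map hm.aemeasurable (measurable_of_countable _).aestronglyMeasurable]

theorem integral_historyLaw_succ_le {F : History U K (t + 1) → ℝ} {G : History U K t → ℝ}
    (hF : Measurable F) (hG : Measurable G) (hFi : Integrable F (historyLaw A D (t + 1)))
    (hGi : Integrable G (historyLaw A D t))
    (h : ∀ᵐ x ∂(stepLaw A D t), F (appendRound x) ≤ G x.1) :
    ∫ h, F h ∂(historyLaw A D (t + 1)) ≤ ∫ h, G h ∂(historyLaw A D t) := by
  rw [integral_historyLaw_succ A D t hF, ← integral_stepLaw_fst A D t hG]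
  rw [historyLaw_succ] at hFi
  exact integral_mono_ae (hFi.comp_measurable measurable_appendRound)
    (integrable_stepLaw_fst A D t hGi) h

end Step

/-! ### Rewards and expected rewards -/

section Rewards

variable {U K : ℕ}

theorem sum_appendRound {M : Type*} [AddCommMonoid M] {t : ℕ} (f : Round U K → M)
    (x : History U K t × Round U K) :
    ∑ s, f (appendRound x s) = ∑ s, f (x.1 s) + f x.2 := by
  simp [appendRound, Fin.sum_univ_castSucc]

theorem prod_appendRound {M : Type*} [CommMonoid M] {t : ℕ} (f : Round U K → M)
    (x : History U K t × Round U K) :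
    ∏ s, f (appendRound x s) = (∏ s, f (x.1 s)) * f x.2 := by
  simp [appendRound, Fin.prod_univ_castSucc]

theorem RewardModel.integrable_id (D : RewardModel U K) (u : Fin U) (k : Fin K) :
    Integrable (fun x => x) (D.D u k) :=
  Integrable.of_mem_Icc 0 1 aemeasurable_id (D.support u k)

theorem RewardModel.mean_mem_Icc (D : RewardModel U K) (u : Fin U) (k : Fin K) :
    D.mean u k ∈ Set.Icc (0 : ℝ) 1 := by
  constructor
  · exact integral_nonneg_of_ae ((D.support u k).mono fun x hx => hx.1)
  · have := integral_mono_ae (D.integrable_id u k) (integrable_const (1 : ℝ))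
      ((D.support u k).mono fun x hx => hx.2)
    simp only [integral_const, probReal_univ, smul_eq_mul, mul_one] at this
    exact this

theorem RewardModel.value_nonneg (D : RewardModel U K) (π : Matching U K) : 0 ≤ D.value π :=
  Finset.sum_nonneg fun u _ => (D.mean_mem_Icc u _).1

theorem RewardModel.value_le (D : RewardModel U K) (π : Matching U K) : D.value π ≤ U := by
  calc D.value π ≤ ∑ _u : Fin U, (1 : ℝ) := Finset.sum_le_sum fun u _ => (D.mean_mem_Icc u _).2
    _ = U := by simp

theorem RewardModel.ae_rewardKernel (D : RewardModel U K) (π : Matching U K) :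
    ∀ᵐ r ∂(D.rewardKernel π), ∀ u, r u ∈ Set.Icc (0 : ℝ) 1 := by
  rw [ae_all_iff]
  intro u
  rw [rewardKernel_apply]
  exact (measurePreserving_eval (fun u => D.D u (π u)) u).quasiMeasurePreserving.ae
    (D.support u (π u))

theorem RewardModel.integral_rewardKernel_eval (D : RewardModel U K) (π : Matching U K) (u : Fin U)
    {f : ℝ → ℝ} (hf : Measurable f) :
    ∫ r, f (r u) ∂(D.rewardKernel π) = ∫ x, f x ∂(D.D u (π u)) := by
  rw [rewardKernel_apply, ← (measurePreserving_eval (fun u => D.D u (π u)) u).map_eq,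
    integral_map (measurable_pi_apply u).aemeasurable hf.aestronglyMeasurable]

theorem RewardModel.lintegral_rewardKernel_eval (D : RewardModel U K) (π : Matching U K)
    (u : Fin U) {f : ℝ → ℝ≥0∞} (hf : Measurable f) :
    ∫⁻ r, f (r u) ∂(D.rewardKernel π) = ∫⁻ x, f x ∂(D.D u (π u)) := by
  rw [rewardKernel_apply, ← (measurePreserving_eval (fun u => D.D u (π u)) u).map_eq,
    lintegral_map hf (measurable_pi_apply u)]

theorem RewardModel.integral_rewardKernel_sum (D : RewardModel U K) (π : Matching U K) :
    ∫ r, ∑ u, r u ∂(D.rewardKernel π) = D.value π := by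
  rw [integral_finsetSum]
  · exact Finset.sum_congr rfl fun u _ =>
      D.integral_rewardKernel_eval π u (f := fun x => x) measurable_id
  · intro u _
    exact Integrable.of_mem_Icc 0 1 (measurable_pi_apply u).aemeasurable
      ((D.ae_rewardKernel π).mono fun r hr => hr u)

variable {b : BudgetConstraint K} (A : Learner U b) (D : RewardModel U K)

theorem measurable_sum_history {t : ℕ} {φ : Round U K → ℝ} (hφ : Measurable φ) :
    Measurable fun h : History U K t => ∑ s, φ (h s) :=
  Finset.measurable_sum _ fun s _ => hφ.comp (measurable_pi_apply s)

theorem measurable_fst_round {β : Type*} [MeasurableSpace β] (f : Matching U K → β) :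
    Measurable fun x : Round U K => f x.1 :=
  (measurable_of_countable f).comp measurable_fst

theorem ae_stepLaw_round {t : ℕ} {p : Round U K → Prop} (hp : MeasurableSet {x | p x})
    (h : ∀ π, ∀ᵐ r ∂(D.rewardKernel π), p (π, r)) : ∀ᵐ x ∂(stepLaw A D t), p x.2 :=
  ae_stepLaw_of_ae_ae A D t (hp.preimage measurable_snd)
    (Filter.Eventually.of_forall fun _ => Filter.Eventually.of_forall fun π => h π)

/-- Sums over the rounds of a quantity that is almost surely bounded have the expectation of the
sums of the conditional expectations given the matchings. -/
theorem integrable_sum_and_integral_sum (t : ℕ) {φ : Round U K → ℝ} (hφ : Measurable φ) {a c : ℝ}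
    (hb : ∀ π, ∀ᵐ r ∂(D.rewardKernel π), φ (π, r) ∈ Set.Icc a c) :
    Integrable (fun h => ∑ s, φ (h s)) (historyLaw A D t) ∧
    Integrable (fun h => ∑ s, ∫ r, φ ((h s).1, r) ∂(D.rewardKernel (h s).1))
      (historyLaw A D t) ∧
    ∫ h, ∑ s, φ (h s) ∂(historyLaw A D t) =
      ∫ h, ∑ s, ∫ r, φ ((h s).1, r) ∂(D.rewardKernel (h s).1) ∂(historyLaw A D t) := by
  have hψ : Measurable fun x : Round U K => ∫ r, φ (x.1, r) ∂(D.rewardKernel x.1) :=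
    measurable_fst_round fun π => ∫ r, φ (π, r) ∂(D.rewardKernel π)
  induction t with
  | zero => simp
  | succ t ih =>
    obtain ⟨i1, i2, i3⟩ := ih
    have hi : Integrable (fun x => φ x.2) (stepLaw A D t) :=
      Integrable.of_mem_Icc a c (hφ.comp measurable_snd).aemeasurable
        (ae_stepLaw_round A D (p := fun x => φ x ∈ Set.Icc a c) (hφ measurableSet_Icc) hb)
    have hi2 : Integrable (fun x => ∫ r, φ (x.2.1, r) ∂(D.rewardKernel x.2.1)) (stepLaw A D t) := by
      refine Integrable.of_mem_Icc a c (hψ.comp measurable_snd).aemeasurable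
        (Filter.Eventually.of_forall fun x => ?_)
      have hI : Integrable (fun r => φ (x.2.1, r)) (D.rewardKernel x.2.1) :=
        Integrable.of_mem_Icc a c (hφ.comp measurable_prodMk_left).aemeasurable (hb x.2.1)
      constructor
      · have := integral_mono_ae (integrable_const a) hI ((hb x.2.1).mono fun r hr => hr.1)
        simpa using this
      · have := integral_mono_ae hI (integrable_const c) ((hb x.2.1).mono fun r hr => hr.2)
        simpa using this
    have e1 := integrable_stepLaw_fst A D t i1
    have e2 := integrable_stepLaw_fst A D t i2
    refine ⟨?_, ?_, ?_⟩
    · rw [historyLaw_succ, integrable_map_measure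
        (measurable_sum_history hφ).aestronglyMeasurable measurable_appendRound.aemeasurable]
      exact (e1.add hi).congr (Filter.Eventually.of_forall fun x =>
        (sum_appendRound φ x).symm)
    · rw [historyLaw_succ, integrable_map_measure
        (measurable_sum_history hψ).aestronglyMeasurable measurable_appendRound.aemeasurable]
      exact (e2.add hi2).congr (Filter.Eventually.of_forall fun x =>
        (sum_appendRound (fun x => ∫ r, φ (x.1, r) ∂(D.rewardKernel x.1)) x).symm)
    · rw [integral_historyLaw_succ A D t (measurable_sum_history hφ),
        integral_historyLaw_succ A D t (measurable_sum_history hψ)]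
      simp_rw [sum_appendRound φ,
        sum_appendRound (fun x : Round U K => ∫ r, φ (x.1, r) ∂(D.rewardKernel x.1))]
      rw [integral_add e1 hi, integral_add e2 hi2, integral_stepLaw_round A D t hφ hi,
        integral_stepLaw_fst A D t (measurable_sum_history hφ),
        integral_stepLaw_fst A D t (measurable_sum_history hψ), i3]

theorem integral_rewards (T : ℕ) :
    ∫ h, ∑ t, ∑ u, (h t).2 u ∂(historyLaw A D T) =
      ∫ h, ∑ t, D.value (h t).1 ∂(historyLaw A D T) := by
  have := (integrable_sum_and_integral_sum A D T (φ := fun x => ∑ u, x.2 u) (a := 0) (c := U)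
    (Finset.measurable_sum _ fun u _ => (measurable_pi_apply u).comp measurable_snd)
    (fun π => (D.ae_rewardKernel π).mono fun r hr =>
      ⟨Finset.sum_nonneg fun u _ => (hr u).1,
        (Finset.sum_le_sum fun u _ => (hr u).2).trans (by simp)⟩)).2.2
  simpa only [D.integral_rewardKernel_sum] using this

theorem integrable_of_bounded {t : ℕ} {F : History U K t → ℝ} (hF : Measurable F) {c : ℝ}
    (h : ∀ x, |F x| ≤ c) : Integrable F (historyLaw A D t) :=
  Integrable.of_mem_Icc (-c) c hF.aemeasurable
    (Filter.Eventually.of_forall fun x => abs_le.1 (h x))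

theorem integrable_sum_matching {t : ℕ} (f : Matching U K → ℝ) :
    Integrable (fun h : History U K t => ∑ s, f (h s).1) (historyLaw A D t) := by
  refine integrable_of_bounded A D (measurable_sum_history (measurable_fst_round f))
    (c := t * ∑ π, |f π|) fun h => ?_
  calc |∑ s, f (h s).1| ≤ ∑ s, |f (h s).1| := Finset.abs_sum_le_sum_abs _ _
    _ ≤ ∑ _s : Fin t, ∑ π, |f π| := Finset.sum_le_sum fun s _ =>
        Finset.single_le_sum (f := fun π => |f π|) (fun π _ => abs_nonneg _) (Finset.mem_univ _)
    _ = t * ∑ π, |f π| := by simp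

/-- The reward noise averages out given the matchings, so pathwise bounds on the losses of the
matchings become bounds on the regret. -/
theorem regret_eq (T : ℕ) :
    regret T A D = ∫ h, ∑ t, (D.optValue b - D.value (h t).1) ∂(historyLaw A D T) := by
  unfold regret
  simp_rw [Finset.sum_sub_distrib]
  rw [integral_sub (integrable_const _) (integrable_sum_matching A D D.value), integral_rewards]
  simp

end Rewards

/-! ### Change of measure -/

section ChangeOfMeasure

variable {U K : ℕ}

/-- It suffices to compare boxes. On a box, the density involves only coordinate `u`, and the other
coordinates contribute the same factors to both sides. -/
theorem pi_withDensity_update {ι : Type*} [Fintype ι] [DecidableEq ι] (μ ν : ι → Measure ℝ)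
    [∀ i, IsProbabilityMeasure (μ i)] [∀ i, IsProbabilityMeasure (ν i)] (u : ι)
    {g : ℝ → ℝ≥0∞} (hg : Measurable g) (hu : ν u = (μ u).withDensity g)
    (hne : ∀ i, i ≠ u → ν i = μ i) :
    Measure.pi ν = (Measure.pi μ).withDensity fun r => g (r u) := by
  refine Measure.pi_eq fun s hs => ?_
  rw [withDensity_apply _ (MeasurableSet.univ_pi hs), Measure.restrict_pi_pi,
    ← lintegral_map (f := g) hg (measurable_pi_apply u),
    show Measure.map (fun r : ι → ℝ => r u) (Measure.pi fun i => (μ i).restrict (s i)) = _ from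
      Measure.pi_map_eval (μ := fun i => (μ i).restrict (s i)) u, lintegral_smul_measure, ← withDensity_apply _ (hs u), ← hu,
    ← Finset.prod_erase_mul _ _ (Finset.mem_univ u), smul_eq_mul]
  congr 1
  refine Finset.prod_congr rfl fun i hi => ?_
  rw [hne i (Finset.ne_of_mem_erase hi), Measure.restrict_apply_univ]

/-- The likelihood ratio of a round when only the law of the pair `(u, j)` changes, with
density `g`. -/
noncomputable def roundLikelihood (u : Fin U) (j : Fin K) (g : ℝ → ℝ) (x : Round U K) : ℝ :=
  if x.1 u = j then g (x.2 u) else 1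

theorem measurable_roundLikelihood (u : Fin U) (j : Fin K) {g : ℝ → ℝ} (hg : Measurable g) :
    Measurable (roundLikelihood (U := U) (K := K) u j g) := by
  refine Measurable.ite ?_ (hg.comp ((measurable_pi_apply u).comp measurable_snd)) measurable_const
  exact measurable_fst (Set.to_countable {π : Matching U K | π u = j}).measurableSet

theorem measurable_prod_roundLikelihood (u : Fin U) (j : Fin K) {g : ℝ → ℝ} (hg : Measurable g)
    (t : ℕ) : Measurable fun h : History U K t => ∏ s, roundLikelihood u j g (h s) :=
  Finset.measurable_prod _ fun s _ =>
    (measurable_roundLikelihood u j hg).comp (measurable_pi_apply s)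

theorem roundLikelihood_pos (u : Fin U) (j : Fin K) {g : ℝ → ℝ} (hg : ∀ x, 0 < g x)
    (x : Round U K) : 0 < roundLikelihood u j g x := by
  unfold roundLikelihood
  split_ifs
  exacts [hg _, one_pos]

theorem lintegral_rewardKernel_change {D D' : RewardModel U K} {u : Fin U} {j : Fin K}
    {g : ℝ → ℝ} (hg : Measurable g)
    (hu : D'.D u j = (D.D u j).withDensity fun x => ENNReal.ofReal (g x))
    (hne : ∀ v k, (v, k) ≠ (u, j) → D'.D v k = D.D v k) (π : Matching U K)
    {f : (Fin U → ℝ) → ℝ≥0∞} (hf : Measurable f) :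
    ∫⁻ r, f r ∂(D'.rewardKernel π) =
      ∫⁻ r, ENNReal.ofReal (roundLikelihood u j g (π, r)) * f r ∂(D.rewardKernel π) := by
  by_cases h : π u = j
  · have hm : Measurable fun r : Fin U → ℝ => ENNReal.ofReal (g (r u)) :=
      (hg.comp (measurable_pi_apply u)).ennreal_ofReal
    rw [rewardKernel_apply, pi_withDensity_update (fun v => D.D v (π v)) (fun v => D'.D v (π v)) u
      (g := fun x => ENNReal.ofReal (g x)) hg.ennreal_ofReal (by rw [h]; exact hu)
      (fun v hv => hne v _ (by simp [hv])), lintegral_withDensity_eq_lintegral_mul _ hm hf]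
    simp [roundLikelihood, h, rewardKernel_apply]
  · have : D'.rewardKernel π = D.rewardKernel π := by
      rw [rewardKernel_apply, rewardKernel_apply]
      congr 1
      ext1 v
      refine hne v _ fun hv => h ?_
      simp only [Prod.mk.injEq] at hv
      rw [← hv.1]; exact hv.2
    simp [this, roundLikelihood, h]

/-- The law of the history after changing the reward law of a single pair is given by the product
of the likelihood ratios of the rounds. -/
theorem historyLaw_eq_withDensity {b : BudgetConstraint K} (A : Learner U b)
    {D D' : RewardModel U K} {u : Fin U} {j : Fin K}
    {g : ℝ → ℝ} (hg : Measurable g) (hpos : ∀ x, 0 < g x)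
    (hu : D'.D u j = (D.D u j).withDensity fun x => ENNReal.ofReal (g x))
    (hne : ∀ v k, (v, k) ≠ (u, j) → D'.D v k = D.D v k) (t : ℕ) :
    historyLaw A D' t = (historyLaw A D t).withDensity fun h =>
      ENNReal.ofReal (∏ s, roundLikelihood u j g (h s)) := by
  have hl := measurable_roundLikelihood u j hg
  have hL : ∀ t, Measurable fun h : History U K t =>
      ENNReal.ofReal (∏ s, roundLikelihood u j g (h s)) := fun t =>
    (measurable_prod_roundLikelihood u j hg t).ennreal_ofReal
  induction t with
  | zero => simp [historyLaw]
  | succ t ih =>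
    refine Measure.ext_of_lintegral _ fun f hf => ?_
    have hfa : Measurable fun x : History U K t × Round U K => f (appendRound x) :=
      hf.comp measurable_appendRound
    have hA : Measurable fun x : History U K t × Round U K => f (appendRound x) *
        ENNReal.ofReal (roundLikelihood u j g x.2) :=
      hfa.mul (hl.comp measurable_snd).ennreal_ofReal
    have hin : Measurable fun h : History U K t => ∫⁻ π, ∫⁻ r, f (appendRound (h, (π, r))) *
        ENNReal.ofReal (roundLikelihood u j g (π, r)) ∂(D.rewardKernel π) ∂(A.policy t h) := by
      have := Measurable.lintegral_kernel_prod_right (κ := roundKernel A D t)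
        (f := fun h x => f (appendRound (h, x)) * ENNReal.ofReal (roundLikelihood u j g x)) hA
      convert! this using 2 with h
      exact (Kernel.lintegral_compProd (A.policy t)
        (Kernel.prodMkLeft (History U K t) D.rewardKernel) h
        (hA.comp measurable_prodMk_left)).symm
    rw [lintegral_withDensity_eq_lintegral_mul _ (hL _) hf,
      lintegral_historyLaw_succ A D t ((hL _).mul hf), lintegral_historyLaw_succ A D' t hf]
    -- The policy sees only the history and is the same in both environments, so a round contributes
    -- a likelihood ratio through its rewards alone.
    have e1 : ∀ h : History U K t, ∀ π, ∫⁻ r, f (appendRound (h, (π, r))) ∂(D'.rewardKernel π) =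
        ∫⁻ r, f (appendRound (h, (π, r))) *
          ENNReal.ofReal (roundLikelihood u j g (π, r)) ∂(D.rewardKernel π) := by
      intro h π
      rw [lintegral_rewardKernel_change hg hu hne π
        (f := fun r => f (appendRound (h, (π, r))))
        (hfa.comp (measurable_prodMk_left.comp measurable_prodMk_left))]
      simp_rw [mul_comm]
    simp_rw [e1]
    rw [ih, lintegral_withDensity_eq_lintegral_mul _ (hL t) hin]
    refine lintegral_congr fun h => ?_
    simp only [Pi.mul_apply]
    rw [← lintegral_const_mul _ (measurable_of_countable _)]
    refine lintegral_congr fun π => ?_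
    have hAr : Measurable fun r : Fin U → ℝ => f (appendRound (h, (π, r))) *
        ENNReal.ofReal (roundLikelihood u j g (π, r)) :=
      hA.comp (measurable_prodMk_left.comp measurable_prodMk_left)
    rw [← lintegral_const_mul _ hAr]
    refine lintegral_congr fun r => ?_
    rw [prod_appendRound, ENNReal.ofReal_mul
      (Finset.prod_nonneg fun s _ => (roundLikelihood_pos u j hpos _).le)]
    ring

end ChangeOfMeasure

/-! ### The hard instances -/

section HardInstances

variable {U K : ℕ}

/-- The Bernoulli law with parameter `1 / 2 + e`. -/
noncomputable def biasedCoin (e : ℝ) : Measure ℝ :=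
  ENNReal.ofReal (1 / 2 + e) • Measure.dirac 1 + ENNReal.ofReal (1 / 2 - e) • Measure.dirac 0

theorem isProbabilityMeasure_biasedCoin {e : ℝ} (he : |e| ≤ 1 / 2) :
    IsProbabilityMeasure (biasedCoin e) := by
  obtain ⟨h1, h2⟩ := abs_le.1 he
  refine ⟨?_⟩
  simp only [biasedCoin, Measure.coe_add, Measure.coe_smul, Pi.add_apply, Pi.smul_apply,
    measure_univ, smul_eq_mul, mul_one]
  rw [← ENNReal.ofReal_add (by linarith) (by linarith)]
  norm_num

theorem biasedCoin_support (e : ℝ) : ∀ᵐ x ∂(biasedCoin e), x ∈ Set.Icc (0 : ℝ) 1 := by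
  have h : ∀ a : ℝ, a ∈ Set.Icc (0 : ℝ) 1 → ∀ᵐ x ∂(Measure.dirac a), x ∈ Set.Icc (0 : ℝ) 1 :=
    fun a ha => (ae_dirac_iff measurableSet_Icc).2 ha
  rw [biasedCoin, ae_add_measure_iff]
  exact ⟨Measure.ae_smul_measure (h 1 (by simp)) _, Measure.ae_smul_measure (h 0 (by simp)) _⟩

theorem integral_biasedCoin {e : ℝ} (he : |e| ≤ 1 / 2) (f : ℝ → ℝ) :
    ∫ x, f x ∂(biasedCoin e) = (1 / 2 + e) * f 1 + (1 / 2 - e) * f 0 := by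
  obtain ⟨h1, h2⟩ := abs_le.1 he
  have hi : ∀ a : ℝ, Integrable f (Measure.dirac a) := fun a =>
    integrable_dirac (by simp)
  rw [biasedCoin, integral_add_measure ((hi 1).smul_measure ENNReal.ofReal_ne_top)
    ((hi 0).smul_measure ENNReal.ofReal_ne_top), integral_smul_measure, integral_smul_measure,
    integral_dirac, integral_dirac, ENNReal.toReal_ofReal (by linarith),
    ENNReal.toReal_ofReal (by linarith)]
  rfl

/-- The density of a biased coin with respect to the fair one. -/
noncomputable def coinTilt (e x : ℝ) : ℝ := if x = 1 then 1 + 2 * e else 1 - 2 * e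

theorem measurable_coinTilt (e : ℝ) : Measurable (coinTilt e) :=
  Measurable.ite (measurableSet_singleton 1) measurable_const measurable_const

theorem coinTilt_mem_Icc {e : ℝ} (he : 0 ≤ e) (x : ℝ) :
    coinTilt e x ∈ Set.Icc (1 - 2 * e) (1 + 2 * e) := by
  unfold coinTilt
  split_ifs <;> constructor <;> linarith

theorem biasedCoin_eq_withDensity {e : ℝ} (he : |e| ≤ 1 / 2) :
    biasedCoin e = (biasedCoin 0).withDensity fun x => ENNReal.ofReal (coinTilt e x) := by
  obtain ⟨h1, h2⟩ := abs_le.1 he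
  refine Measure.ext_of_lintegral _ fun f hf => ?_
  rw [lintegral_withDensity_eq_lintegral_mul _ (measurable_coinTilt e).ennreal_ofReal hf]
  simp only [biasedCoin, lintegral_add_measure, lintegral_smul_measure, lintegral_dirac,
    Pi.mul_apply, coinTilt, smul_eq_mul, if_true, zero_ne_one, if_false, ← mul_assoc]
  rw [← ENNReal.ofReal_mul (by norm_num), ← ENNReal.ofReal_mul (by norm_num)]
  ring_nf

/-- The instance in which all rewards are fair coins, except that the arm `κ u`, if there is one,
has the bias `e` for the user `u`. -/
noncomputable def coinModel (e : ℝ) (he : |e| ≤ 1 / 2) (κ : Fin U → Option (Fin K)) :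
    RewardModel U K where
  D u k := biasedCoin (if κ u = some k then e else 0)
  isProb u k := isProbabilityMeasure_biasedCoin (by split_ifs <;> first | exact he | norm_num)
  support u k := biasedCoin_support _

theorem coinModel_mean {e : ℝ} (he : |e| ≤ 1 / 2) (κ : Fin U → Option (Fin K)) (u : Fin U)
    (k : Fin K) : (coinModel e he κ).mean u k = 1 / 2 + if κ u = some k then e else 0 := by
  have : |if κ u = some k then e else 0| ≤ 1 / 2 := by split_ifs <;> first | exact he | norm_num
  exact (integral_biasedCoin this _).trans (by ring)

/-- The number of pulls of a pair, as a real number. -/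
noncomputable def pulls {t : ℕ} (u : Fin U) (k : Fin K) (h : History U K t) : ℝ :=
  ∑ s, if (h s).1 u = k then 1 else 0

theorem measurable_pulls {t : ℕ} (u : Fin U) (k : Fin K) :
    Measurable (pulls (t := t) u k : History U K t → ℝ) :=
  measurable_sum_history (φ := fun x => if x.1 u = k then 1 else 0)
    (measurable_fst_round fun π : Matching U K => if π u = k then (1 : ℝ) else 0)

theorem pulls_nonneg {t : ℕ} (u : Fin U) (k : Fin K) (h : History U K t) : 0 ≤ pulls u k h :=
  Finset.sum_nonneg fun s _ => by split_ifs <;> norm_num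

theorem sum_pulls {t : ℕ} (u : Fin U) (h : History U K t) : ∑ k, pulls u k h = t := by
  unfold pulls
  rw [Finset.sum_comm]
  simp

theorem pulls_le {t : ℕ} (u : Fin U) (k : Fin K) (h : History U K t) : pulls u k h ≤ t := by
  rw [← sum_pulls u h]
  exact Finset.single_le_sum (fun k _ => pulls_nonneg u k h) (Finset.mem_univ k)

theorem integrable_pulls {b : BudgetConstraint K} (A : Learner U b) (D : RewardModel U K) {t : ℕ}
    (u : Fin U) (k : Fin K) : Integrable (pulls u k) (historyLaw A D t) :=
  integrable_of_bounded A D (measurable_pulls u k) fun h => by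
    rw [abs_of_nonneg (pulls_nonneg u k h)]; exact pulls_le u k h

/-- A pointwise substitute for Pinsker's inequality, with `x` a likelihood ratio: `x - 1 - log x`
integrates to the relative entropy and `(x + 1) / 16` to `1 / 8`. With `y = √x`, `log y ≤ y - 1`
gives `x - 1 - log x ≥ (y - 1)²`; then `(y - 1)(y + 1) ≤ 8 (y - 1)² + (y + 1)² / 32` and `(y + 1)² ≤
2 (x + 1)`. -/
theorem sub_one_le_of_log {x : ℝ} (hx : 0 < x) :
    x - 1 ≤ 8 * (x - 1 - Real.log x) + (x + 1) / 16 := by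
  have hy := Real.sqrt_pos.2 hx
  have h1 : Real.log x = 2 * Real.log (√x) := by rw [Real.log_sqrt hx.le]; ring
  have h2 := Real.log_le_sub_one_of_pos hy
  have h3 := Real.sq_sqrt hx.le
  generalize √x = y at *
  subst h3
  nlinarith [sq_nonneg (16 * (y - 1) - (y + 1)), sq_nonneg (y - 1)]

theorem log_one_sub_ge {x : ℝ} (h0 : 0 ≤ x) (h1 : x ≤ 1 / 2) : -(2 * x) ≤ Real.log (1 - x) := by
  have hp : 0 < 1 - x := by linarith
  have h := Real.one_sub_inv_le_log_of_pos hp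
  refine le_trans ?_ h
  have : (1 - x)⁻¹ ≤ 1 + 2 * x := by
    rw [inv_le_iff_one_le_mul₀ hp]; nlinarith
  linarith

/-- If the pair `(u, j)` becomes better by `e`, its expected number of pulls grows only little
unless it was pulled often before. -/
theorem integral_pulls_le {b : BudgetConstraint K} (A : Learner U b) {e : ℝ} (h0 : 0 ≤ e)
    (h1 : e ≤ 1 / 4) (he : |e| ≤ 1 / 2) (κ : Fin U → Option (Fin K)) (u : Fin U)
    (j : Fin K) (T : ℕ) :
    ∫ h, pulls u j h ∂(historyLaw A (coinModel e he (Function.update κ u (some j))) T) ≤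
      ∫ h, pulls u j h ∂(historyLaw A (coinModel e he (Function.update κ u none)) T) +
      T * (8 * (4 * e ^ 2) * ∫ h, pulls u j h
        ∂(historyLaw A (coinModel e he (Function.update κ u none)) T) + 1 / 8) := by
  set D' := coinModel e he (Function.update κ u (some j))
  set D := coinModel e he (Function.update κ u none)
  have hg := measurable_coinTilt e
  have hpos : ∀ x, 0 < coinTilt e x := fun x =>
    lt_of_lt_of_le (by linarith) (coinTilt_mem_Icc h0 x).1
  have hDu : D.D u j = biasedCoin 0 := by simp [D, coinModel]
  have hlaw := historyLaw_eq_withDensity A (D := D) (D' := D') (u := u) (j := j) hg hpos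
    (by rw [hDu, ← biasedCoin_eq_withDensity he]; simp [D', coinModel])
    (by
      intro v k hv
      by_cases hvu : v = u
      · subst hvu
        have : j ≠ k := fun hk => hv (by rw [hk])
        simp [D, D', coinModel, this]
      · simp [D, D', coinModel, hvu]) T
  set L : History U K T → ℝ := fun h => ∏ s, roundLikelihood u j (coinTilt e) (h s)
  have hl := measurable_roundLikelihood (U := U) u j hg
  have hLm : Measurable L := measurable_prod_roundLikelihood u j hg T
  have hLpos : ∀ h, 0 < L h := fun h => Finset.prod_pos fun s _ => roundLikelihood_pos u j hpos _
  have hlmem : ∀ x, roundLikelihood u j (coinTilt e) x ∈ Set.Icc (1 - 2 * e) (1 + 2 * e) := by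
    intro x
    unfold roundLikelihood
    split_ifs
    · exact coinTilt_mem_Icc h0 _
    · constructor <;> linarith
  have hLle : ∀ h, L h ≤ (1 + 2 * e) ^ T := fun h => by
    calc L h ≤ ∏ _s : Fin T, (1 + 2 * e) :=
          Finset.prod_le_prod (fun s _ => (roundLikelihood_pos u j hpos _).le)
            fun s _ => (hlmem _).2
      _ = (1 + 2 * e) ^ T := by simp
  have hLi : Integrable L (historyLaw A D T) := integrable_of_bounded A D hLm fun h => by
    rw [abs_of_pos (hLpos h)]; exact hLle h
  have hchange : ∀ F : History U K T → ℝ,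
      ∫ h, F h ∂(historyLaw A D' T) = ∫ h, L h * F h ∂(historyLaw A D T) := by
    intro F
    rw [hlaw, integral_withDensity_eq_integral_toReal_smul hLm.ennreal_ofReal
      (Filter.Eventually.of_forall fun h => ENNReal.ofReal_lt_top)]
    refine integral_congr_ae (Filter.Eventually.of_forall fun h => ?_)
    simp only [smul_eq_mul]
    rw [ENNReal.toReal_ofReal (hLpos h).le]
  have hL1 : ∫ h, L h ∂(historyLaw A D T) = 1 := by
    have := hchange fun _ => 1
    simpa using this.symm
  -- the relative entropy
  obtain ⟨hlogi, -, hlog⟩ := integrable_sum_and_integral_sum A D T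
    (φ := fun x => Real.log (roundLikelihood u j (coinTilt e) x)) hl.log
    (a := Real.log (1 - 2 * e)) (c := Real.log (1 + 2 * e))
    (fun π => Filter.Eventually.of_forall fun r =>
      ⟨Real.log_le_log (by linarith) (hlmem _).1,
        Real.log_le_log (roundLikelihood_pos u j hpos _) (hlmem _).2⟩)
  have hlogL : ∀ h, Real.log (L h) =
      ∑ s, Real.log (roundLikelihood u j (coinTilt e) (h s)) := fun h =>
    Real.log_prod fun s _ => (roundLikelihood_pos u j hpos _).ne'
  -- Only pulls of `(u, j)` carry information. Under the fair coin, each contributes the mean of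
  -- `log (1 + 2e)` and `log (1 - 2e)`, which is at least `-4e²`.
  have hcond : ∀ π : Matching U K,
      ∫ r, Real.log (roundLikelihood u j (coinTilt e) (π, r)) ∂(D.rewardKernel π) =
      (1 / 2 * Real.log (1 - (2 * e) ^ 2)) * if π u = j then 1 else 0 := by
    intro π
    by_cases hπ : π u = j
    · simp only [roundLikelihood, hπ, if_true, mul_one]
      rw [D.integral_rewardKernel_eval π u (f := fun x => Real.log (coinTilt e x)) hg.log, hπ, hDu,
        integral_biasedCoin (by norm_num)]
      have : (1 : ℝ) - (2 * e) ^ 2 = (1 + 2 * e) * (1 - 2 * e) := by ring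
      rw [this, Real.log_mul (by linarith) (by linarith)]
      simp [coinTilt]
      ring
    · simp [roundLikelihood, hπ]
  have hN := integrable_pulls A D (t := T) u j
  have hent : -(4 * e ^ 2) * ∫ h, pulls u j h ∂(historyLaw A D T) ≤
      ∫ h, Real.log (L h) ∂(historyLaw A D T) := by
    simp_rw [hlogL]
    rw [hlog]
    simp_rw [hcond, ← Finset.mul_sum]
    rw [integral_const_mul]
    refine mul_le_mul_of_nonneg_right ?_ (integral_nonneg fun h => pulls_nonneg u j h)
    have := log_one_sub_ge (x := (2 * e) ^ 2) (by positivity) (by nlinarith)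
    linarith
  have hlogi' : Integrable (fun h => Real.log (L h)) (historyLaw A D T) := by
    simp_rw [hlogL]; exact hlogi
  -- Write `L * N = N + N * (L - 1)`, bound `L - 1` by `sub_one_le_of_log`, and then replace `N` by
  -- `T`, which is allowed since the resulting bracket is nonnegative.
  have hpt : ∀ h, L h * pulls u j h ≤
      pulls u j h + T * (8 * (L h - 1 - Real.log (L h)) + (L h + 1) / 16) := by
    intro h
    have e1 := sub_one_le_of_log (hLpos h)
    have e2 := Real.log_le_sub_one_of_pos (hLpos h)
    have e3 := hLpos h
    have e4 := pulls_nonneg u j h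
    have e5 := pulls_le u j h
    have e6 : pulls u j h * (L h - 1) ≤
        pulls u j h * (8 * (L h - 1 - Real.log (L h)) + (L h + 1) / 16) :=
      mul_le_mul_of_nonneg_left e1 e4
    have e7 := mul_le_mul_of_nonneg_right e5
      (show 0 ≤ 8 * (L h - 1 - Real.log (L h)) + (L h + 1) / 16 by linarith)
    linarith
  have i1 : Integrable (fun h => 8 * (L h - 1 - Real.log (L h))) (historyLaw A D T) :=
    ((hLi.sub (integrable_const 1)).sub hlogi').const_mul 8
  have i2 : Integrable (fun h => (L h + 1) / 16) (historyLaw A D T) :=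
    (hLi.add (integrable_const 1)).div_const 16
  rw [hchange]
  have hmono := integral_mono (μ := historyLaw A D T) (f := fun h => L h * pulls u j h)
    (g := fun h => pulls u j h + T * (8 * (L h - 1 - Real.log (L h)) + (L h + 1) / 16))
    (integrable_of_bounded A D (hLm.mul (measurable_pulls u j)) (c := (1 + 2 * e) ^ T * T)
      fun h => by
        rw [abs_of_nonneg (mul_nonneg (hLpos h).le (pulls_nonneg u j h))]
        exact mul_le_mul (hLle h) (pulls_le u j h) (pulls_nonneg u j h) (by positivity))
    (hN.add ((i1.add i2).const_mul _)) hpt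
  refine hmono.trans ?_
  have i3 : Integrable (fun h => (T : ℝ) * (8 * (L h - 1 - Real.log (L h)) + (L h + 1) / 16))
      (historyLaw A D T) := (i1.add i2).const_mul _
  have i4 : Integrable (fun h => L h - 1) (historyLaw A D T) := hLi.sub (integrable_const 1)
  rw [integral_add hN i3, integral_const_mul, integral_add i1 i2,
    integral_const_mul, integral_sub i4 hlogi',
    integral_sub hLi (integrable_const 1), integral_div,
    integral_add hLi (integrable_const 1), hL1]
  simp only [integral_const, probReal_univ, smul_eq_mul, mul_one]
  refine add_le_add le_rfl (mul_le_mul_of_nonneg_left ?_ (Nat.cast_nonneg T))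
  linarith

end HardInstances

/-! ### Averaging over the hidden arms -/

section LowerBound

variable {U K : ℕ}

/-- Resampling one coordinate preserves the uniform law: exchanging `κ u` with the new value `j` is
an involution on pairs `(κ, j)`. This allows conditioning on the hidden arms of all other users. -/
theorem sum_update_eq {ι α : Type*} [Fintype ι] [DecidableEq ι] [Fintype α] (u : ι)
    (a : (ι → α) → ℝ) :
    ∑ κ : ι → α, ∑ j, a (Function.update κ u j) = Fintype.card α * ∑ κ, a κ := by
  let σ : (ι → α) × α → (ι → α) × α := fun p => (Function.update p.1 u p.2, p.1 u)
  have hσ : Function.Involutive σ := fun p => by simp [σ]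
  have h := Equiv.sum_comp hσ.toPerm fun p => a p.1
  rw [Fintype.sum_prod_type, Fintype.sum_prod_type] at h
  simpa [σ, Function.Involutive.coe_toPerm, Finset.mul_sum] using h

/-- Without costs every matching is feasible. -/
def freeConstraint (K : ℕ) : BudgetConstraint K where
  cost _ := 0
  budget := 0
  cost_le _ := by simp

theorem value_le_optValue (D : RewardModel U K) {b : BudgetConstraint K} {π : Matching U K}
    (hπ : b.Feasible π) : D.value π ≤ D.optValue b :=
  le_ciSup (f := fun π : {π : Matching U K // b.Feasible π} => D.value π.1)
    (Set.finite_range _).bddAbove ⟨π, hπ⟩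

/-- The matching `κ` is itself feasible, and relative to it each user loses exactly `e` in every
round that misses the hidden arm. -/
theorem coinModel_regret_ge (A : Learner U (freeConstraint K)) {e : ℝ} (he : |e| ≤ 1 / 2)
    (κ : Fin U → Fin K) (T : ℕ) :
    e * (U * T - ∑ u, ∫ h, pulls u (κ u) h
      ∂(historyLaw A (coinModel e he fun u => some (κ u)) T)) ≤
    regret T A (coinModel e he fun u => some (κ u)) := by
  set D := coinModel e he fun u => some (κ u)
  have hv : ∀ π : Matching U K, D.value κ - D.value π =
      ∑ u, e * (1 - if π u = κ u then 1 else 0) := by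
    intro π
    unfold RewardModel.value
    rw [← Finset.sum_sub_distrib]
    refine Finset.sum_congr rfl fun u _ => ?_
    rw [coinModel_mean, coinModel_mean]
    by_cases h : π u = κ u
    · simp [h]
    · simp [h, Ne.symm h]
  have hopt : D.value κ ≤ D.optValue (freeConstraint K) :=
    value_le_optValue D (by simp [BudgetConstraint.Feasible, freeConstraint])
  have hsum : ∀ h : History U K T, e * (U * T - ∑ u, pulls u (κ u) h) ≤
      ∑ t, (D.optValue (freeConstraint K) - D.value (h t).1) := by
    intro h
    calc e * (U * T - ∑ u, pulls u (κ u) h) = ∑ t, (D.value κ - D.value (h t).1) := by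
          simp_rw [hv]
          rw [Finset.sum_comm]
          simp_rw [← Finset.mul_sum, Finset.sum_sub_distrib]
          simp [pulls]
      _ ≤ _ := Finset.sum_le_sum fun t _ => by linarith
  rw [regret_eq]
  have hi := fun u => integrable_pulls A D (t := T) u (κ u)
  have i1 : Integrable (fun h : History U K T => ∑ u, pulls u (κ u) h) (historyLaw A D T) :=
    integrable_finsetSum _ fun u _ => hi u
  have i2 : Integrable (fun h : History U K T => (U * T : ℝ) - ∑ u, pulls u (κ u) h)
    (historyLaw A D T) := (integrable_const _).sub i1
  refine le_trans (le_of_eq ?_) (integral_mono (i2.const_mul e)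
    (integrable_sum_matching A D fun π => D.optValue (freeConstraint K) - D.value π) hsum)
  rw [integral_const_mul, integral_sub (integrable_const _) i1,
    integral_finsetSum _ fun u _ => hi u]
  simp

/-- All `K` environments are compared with one in which `u` has no biased arm, where the pull counts
sum to `T`. By the choice of `e`, the entropy terms and the constants `1 / 8` each add up to `K * T
/ 8`, and `T ≤ K * T / 2` since `K ≥ 2`. -/
theorem sum_integral_pulls_le (A : Learner U (freeConstraint K)) {e : ℝ} (h0 : 0 ≤ e)
    (h1 : e ≤ 1 / 4) (he : |e| ≤ 1 / 2) {T : ℕ} (hK : 2 ≤ K) (hT : 256 * e ^ 2 * T = K) (u : Fin U)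
    (κ : Fin U → Fin K) :
    ∑ j, ∫ h, pulls u j h ∂(historyLaw A
      (coinModel e he fun v => some (Function.update κ u j v)) T) ≤ 3 / 4 * (K * T) := by
  set D := coinModel (K := K) e he (Function.update (fun v => some (κ v)) u none)
  have hupd : ∀ j, (fun v => some (Function.update κ u j v)) =
      Function.update (fun v => some (κ v)) u (some j) := by
    intro j
    ext1 v
    by_cases hv : v = u
    · subst hv; simp
    · simp [hv]
  simp_rw [hupd]
  have hbase : ∑ j, ∫ h, pulls u j h ∂(historyLaw A D T) = T := by
    rw [← integral_finsetSum _ fun j _ => integrable_pulls A D u j]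
    simp_rw [sum_pulls]
    simp
  refine (Finset.sum_le_sum fun j _ =>
    integral_pulls_le A h0 h1 he (fun v => some (κ v)) u j T).trans ?_
  rw [Finset.sum_add_distrib, ← Finset.mul_sum, Finset.sum_add_distrib, ← Finset.mul_sum, hbase]
  simp only [Finset.sum_const, Finset.card_univ, Fintype.card_fin, nsmul_eq_mul]
  have hK' : (2 : ℝ) ≤ K := by exact_mod_cast hK
  have hT' : (0 : ℝ) ≤ T := Nat.cast_nonneg T
  have : 8 * (4 * e ^ 2) * (T : ℝ) = K / 8 := by rw [← hT]; ring
  rw [this]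
  nlinarith

/-- Every learner has large regret for some coin model. -/
theorem exists_regret_ge {T : ℕ} (hK : 2 ≤ K) (hKT : K ≤ T) (A : Learner U (freeConstraint K)) :
    ∃ D : RewardModel U K, 1 / 64 * (U * Real.sqrt (K * T)) ≤ regret T A D := by
  have hK' : (2 : ℝ) ≤ K := by exact_mod_cast hK
  have hKT' : (K : ℝ) ≤ T := by exact_mod_cast hKT
  have hTpos : (0 : ℝ) < T := by linarith
  have hs := Real.sq_sqrt (show (0 : ℝ) ≤ K / T by positivity)
  have hs0 := Real.sqrt_nonneg ((K : ℝ) / T)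
  have hs1 : √((K : ℝ) / T) ≤ 1 := Real.sqrt_le_one.2 ((div_le_one hTpos).2 hKT')
  have hKTs : √((K : ℝ) / T) * T = √(K * T) := by
    rw [show (K : ℝ) * T = K / T * T ^ 2 by field_simp, Real.sqrt_mul (by positivity),
      Real.sqrt_sq hTpos.le]
  -- The factor `1 / 16` makes `256 * e ^ 2 * T = K`. A quarter of the rounds missed then gives `e *
  -- T / 4 = √(K * T) / 64` per user.
  set e : ℝ := √((K : ℝ) / T) / 16 with hedef
  have h0 : 0 ≤ e := by positivity
  have h1 : e ≤ 1 / 4 := by linarith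
  have he : |e| ≤ 1 / 2 := by rw [abs_of_nonneg h0]; linarith
  have hT : 256 * e ^ 2 * T = K := by
    rw [hedef, div_pow, hs]; field_simp; norm_num
  have : NeZero K := ⟨by omega⟩
  let a : Fin U → (Fin U → Fin K) → ℝ := fun u κ =>
    ∫ h, pulls u (κ u) h ∂(historyLaw A (coinModel e he fun u => some (κ u)) T)
  have ha : ∀ u, ∑ κ, a u κ ≤ ∑ _κ : Fin U → Fin K, 3 / 4 * (T : ℝ) := by
    intro u
    have hu : (K : ℝ) * ∑ κ, a u κ ≤ K * ∑ _κ : Fin U → Fin K, 3 / 4 * (T : ℝ) := by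
      have := sum_update_eq u (a u)
      rw [Fintype.card_fin] at this
      rw [← this, Finset.mul_sum]
      refine Finset.sum_le_sum fun κ _ => ?_
      have := sum_integral_pulls_le A h0 h1 he hK hT u κ
      simp only [a, Function.update_self]
      linarith
    exact le_of_mul_le_mul_left hu (by linarith)
  -- The average over `κ` is bounded for each user separately; summing over users before choosing
  -- `κ` yields one instance for all of them.
  obtain ⟨κ, -, hκ⟩ : ∃ κ ∈ (Finset.univ : Finset (Fin U → Fin K)),
      ∑ u, a u κ ≤ ∑ _u : Fin U, 3 / 4 * (T : ℝ) := by
    refine Finset.exists_le_of_sum_le Finset.univ_nonempty ?_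
    rw [Finset.sum_comm, Finset.sum_comm (s := (Finset.univ : Finset (Fin U → Fin K)))]
    exact Finset.sum_le_sum fun u _ => ha u
  refine ⟨coinModel e he fun u => some (κ u), le_trans ?_ (coinModel_regret_ge A he κ T)⟩
  have h2 : e * (U * T - 3 / 4 * (U * T)) ≤ e * (U * T - ∑ u, a u κ) := by
    refine mul_le_mul_of_nonneg_left ?_ h0
    simp only [Finset.sum_const, Finset.card_univ, Fintype.card_fin, nsmul_eq_mul] at hκ
    linarith
  refine le_trans (le_of_eq ?_) h2
  rw [← hKTs, hedef]
  ring

end LowerBound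

/-! ### Concentration of the empirical means -/

section Concentration

variable {U K : ℕ}

/-- The sum of the observed rewards of a pair. -/
noncomputable def rewardSum {t : ℕ} (u : Fin U) (k : Fin K) (h : History U K t) : ℝ :=
  ∑ s, if (h s).1 u = k then (h s).2 u else 0

theorem measurableSet_assigned (u : Fin U) (k : Fin K) :
    MeasurableSet {x : Round U K | x.1 u = k} :=
  measurable_fst (Set.to_countable {π : Matching U K | π u = k}).measurableSet

theorem measurable_rewardSum {t : ℕ} (u : Fin U) (k : Fin K) :
    Measurable (rewardSum u k : History U K t → ℝ) :=
  measurable_sum_history (φ := fun x => if x.1 u = k then x.2 u else 0)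
    (Measurable.ite (measurableSet_assigned u k)
      ((measurable_pi_apply u).comp measurable_snd) measurable_const)

theorem pullCount_eq_pulls {t : ℕ} (h : History U K t) (u : Fin U) (k : Fin K) :
    (pullCount h u k : ℝ) = pulls u k h := by
  simp [pullCount, pulls]

theorem empMean_eq {t : ℕ} (h : History U K t) (u : Fin U) (k : Fin K) :
    empMean h u k = rewardSum u k h / pulls u k h := by
  rw [empMean, pullCount_eq_pulls, rewardSum, Finset.sum_filter]

theorem pullCount_pos_iff {t : ℕ} (h : History U K t) (u : Fin U) (k : Fin K) :
    0 < pullCount h u k ↔ 0 < pulls u k h := by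
  rw [← pullCount_eq_pulls]; simp

theorem pullCount_eq_zero_iff {t : ℕ} (h : History U K t) (u : Fin U) (k : Fin K) :
    pullCount h u k = 0 ↔ pulls u k h = 0 := by
  rw [← pullCount_eq_pulls]; simp

theorem measurable_empMean {t : ℕ} (u : Fin U) (k : Fin K) :
    Measurable fun h : History U K t => empMean h u k := by
  simp_rw [empMean_eq]
  exact (measurable_rewardSum u k).div (measurable_pulls u k)

/-- A product of likelihood ratios of mass at most one is a supermartingale. -/
theorem lintegral_prod_roundLikelihood_le {b : BudgetConstraint K} (A : Learner U b)
    (D : RewardModel U K) (u : Fin U) (k : Fin K) {g : ℝ → ℝ} (hg : Measurable g)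
    (hpos : ∀ x, 0 < g x) (h1 : ∫⁻ x, ENNReal.ofReal (g x) ∂(D.D u k) ≤ 1) (t : ℕ) :
    ∫⁻ h, ENNReal.ofReal (∏ s, roundLikelihood u k g (h s)) ∂(historyLaw A D t) ≤ 1 := by
  have hl := measurable_roundLikelihood u k hg
  induction t with
  | zero => simp
  | succ t ih =>
    rw [lintegral_historyLaw_succ A D t (measurable_prod_roundLikelihood u k hg (t + 1)).ennreal_ofReal]
    refine le_trans (lintegral_mono fun h => ?_) ih
    refine (lintegral_mono (g := fun _ => ENNReal.ofReal (∏ s, roundLikelihood u k g (h s)))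
      fun π => ?_).trans (by simp)
    simp_rw [prod_appendRound]
    simp_rw [ENNReal.ofReal_mul
      (Finset.prod_nonneg fun s _ => (roundLikelihood_pos u k hpos (h s)).le)]
    have hm : Measurable fun r : Fin U → ℝ => ENNReal.ofReal (roundLikelihood u k g (π, r)) :=
      (hl.comp measurable_prodMk_left).ennreal_ofReal
    rw [lintegral_const_mul _ hm]
    refine mul_le_of_le_one_right zero_le ?_
    by_cases hπ : π u = k
    · simp only [roundLikelihood, hπ, if_true]
      rw [D.lintegral_rewardKernel_eval π u (f := fun x => ENNReal.ofReal (g x))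
        hg.ennreal_ofReal, hπ]
      exact h1
    · simp [roundLikelihood, hπ]

/-- Hoeffding's lemma: a variable with values in an interval of length one is sub-Gaussian with
variance proxy `1 / 4`. -/
theorem lintegral_exp_le_one (D : RewardModel U K) (u : Fin U) (k : Fin K) (l : ℝ) :
    ∫⁻ x, ENNReal.ofReal (Real.exp (l * (x - D.mean u k) - l ^ 2 / 8)) ∂(D.D u k) ≤ 1 := by
  have h := hasSubgaussianMGF_of_mem_Icc (μ := D.D u k) (X := fun x => x) aemeasurable_id
    (D.support u k)
  change HasSubgaussianMGF (fun x => x - D.mean u k) _ _ at h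
  have hi : Integrable (fun x => Real.exp (l * (x - D.mean u k) - l ^ 2 / 8)) (D.D u k) := by
    simp_rw [Real.exp_sub]
    exact (h.integrable_exp_mul l).div_const _
  rw [← ofReal_integral_eq_lintegral_ofReal hi
    (Filter.Eventually.of_forall fun x => (Real.exp_pos _).le), ENNReal.ofReal_le_one]
  simp_rw [Real.exp_sub]
  rw [integral_div, div_le_one (Real.exp_pos _)]
  refine (h.mgf_le l).trans (le_of_eq ?_)
  congr 1
  simp
  ring

theorem prod_roundLikelihood_exp {t : ℕ} (h : History U K t) (u : Fin U) (k : Fin K) (l θ : ℝ) :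
    ∏ s, roundLikelihood u k (fun x => Real.exp (l * (x - θ) - l ^ 2 / 8)) (h s) =
      Real.exp (l * (rewardSum u k h - pulls u k h * θ) - l ^ 2 / 8 * pulls u k h) := by
  have : ∀ s, roundLikelihood u k (fun x => Real.exp (l * (x - θ) - l ^ 2 / 8)) (h s) =
      Real.exp (l * ((if (h s).1 u = k then (h s).2 u else 0) -
        (if (h s).1 u = k then 1 else 0) * θ) - l ^ 2 / 8 * if (h s).1 u = k then 1 else 0) := by
    intro s
    unfold roundLikelihood
    split_ifs <;> simp
  simp_rw [this, ← Real.exp_sum, Finset.sum_sub_distrib, ← Finset.mul_sum, Finset.sum_sub_distrib,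
    ← Finset.sum_mul]
  rfl

/-- Some empirical mean is far from the true mean. -/
def BadHistory {t : ℕ} (T : ℕ) (D : RewardModel U K) (h : History U K t) : Prop :=
  ∃ u k, 0 < pulls u k h ∧
    Real.sqrt (2 * Real.log T / pulls u k h) < |empMean h u k - D.mean u k|

theorem measurableSet_badHistory {t : ℕ} (T : ℕ) (D : RewardModel U K) :
    MeasurableSet {h : History U K t | BadHistory T D h} := by
  have : {h : History U K t | BadHistory T D h} = ⋃ u, ⋃ k, {h | 0 < pulls u k h ∧
      Real.sqrt (2 * Real.log T / pulls u k h) < |empMean h u k - D.mean u k|} := by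
    ext h; simp [BadHistory]
  rw [this]
  refine MeasurableSet.iUnion fun u => MeasurableSet.iUnion fun k => MeasurableSet.inter ?_ ?_
  · exact measurableSet_lt measurable_const (measurable_pulls u k)
  · exact measurableSet_lt ((measurable_const.div (measurable_pulls u k)).sqrt)
      ((measurable_empMean u k).sub_const _).abs

/-- For width `r` and `n` pulls, the exponent `l * r * n - l² * n / 8` is largest at `l = 4 * r`,
with value `2 * r² * n = 4 * log T`. The unit `σ` is the sign of the deviation. -/
theorem exists_pow_le_prod_of_deviation {t T : ℕ} (hT : 1 ≤ T) {h : History U K t} {u : Fin U}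
    {k : Fin K} {θ : ℝ} (hp : 0 < pulls u k h)
    (hd : Real.sqrt (2 * Real.log T / pulls u k h) < |empMean h u k - θ|) :
    ∃ σ : ℤˣ, (T : ℝ) ^ 4 ≤ ∏ s, roundLikelihood u k
      (fun x => Real.exp ((((σ : ℤ) : ℝ) * (4 * Real.sqrt (2 * Real.log T / pulls u k h))) * (x - θ)
        - (((σ : ℤ) : ℝ) * (4 * Real.sqrt (2 * Real.log T / pulls u k h))) ^ 2 / 8)) (h s) := by
  have hT' : (1 : ℝ) ≤ T := by exact_mod_cast hT
  have hlog : 0 ≤ Real.log T := Real.log_nonneg hT'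
  have hS : rewardSum u k h = empMean h u k * pulls u k h := by
    rw [empMean_eq]; field_simp
  have hr0 := Real.sqrt_nonneg (2 * Real.log T / pulls u k h)
  have hr2 := Real.sq_sqrt (show 0 ≤ 2 * Real.log T / pulls u k h by positivity)
  have hT4 : (T : ℝ) ^ 4 = Real.exp (4 * Real.log T) := by
    rw [mul_comm, Real.exp_mul, Real.exp_log (by linarith)]; norm_cast
  simp_rw [prod_roundLikelihood_exp, hT4, Real.exp_le_exp, hS]
  generalize √(2 * Real.log T / pulls u k h) = r at *
  generalize pulls u k h = n at *
  have hn : n * r ^ 2 = 2 * Real.log T := by rw [hr2]; field_simp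
  generalize empMean h u k = m at *
  have key : ∀ d : ℝ, r ≤ d → 4 * Real.log T ≤ 4 * r * (d * n) - (4 * r) ^ 2 / 8 * n := by
    intro d hd
    have := mul_le_mul_of_nonneg_left hd (show 0 ≤ 4 * r * n by positivity)
    nlinarith
  rcases lt_abs.1 hd with hd | hd
  · refine ⟨1, (key _ hd.le).trans (le_of_eq ?_)⟩
    push_cast
    ring
  · refine ⟨-1, (key _ hd.le).trans (le_of_eq ?_)⟩
    push_cast
    ring

theorem measure_badHistory_le {b : BudgetConstraint K} (A : Learner U b) (D : RewardModel U K)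
    {t T : ℕ} (hT : 1 ≤ T) (htT : t ≤ T) (hU : U ≤ T) (hK : K ≤ T) :
    (historyLaw A D t).real {h | BadHistory T D h} ≤ 2 / T := by
  have hT0 : (0 : ℝ) < T := by exact_mod_cast hT
  -- The supermartingale needs a fixed exponent while the pull count is random, so every positive
  -- count `n + 1 ≤ T` gets its own exponent.
  let l : Fin T → ℤˣ → ℝ := fun n σ =>
    ((σ : ℤ) : ℝ) * (4 * Real.sqrt (2 * Real.log T / ((n : ℕ) + 1 : ℝ)))
  let g : Fin U → Fin K → Fin T → ℤˣ → ℝ → ℝ := fun u k n σ x =>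
    Real.exp (l n σ * (x - D.mean u k) - l n σ ^ 2 / 8)
  let E : Fin U × Fin K × Fin T × ℤˣ → Set (History U K t) := fun i =>
    {h | (T : ℝ) ^ 4 ≤ ∏ s, roundLikelihood i.1 i.2.1 (g i.1 i.2.1 i.2.2.1 i.2.2.2) (h s)}
  have hsub : {h | BadHistory T D h} ⊆ ⋃ i, E i := by
    rintro h ⟨u, k, hp, hd⟩
    have hc : 0 < pullCount h u k := (pullCount_pos_iff h u k).2 hp
    have hcT : pullCount h u k ≤ T := by
      have := pulls_le u k h
      rw [← pullCount_eq_pulls] at this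
      exact (Nat.cast_le.1 this).trans htT
    have hn : ((pullCount h u k - 1 : ℕ) : ℝ) + 1 = pulls u k h := by
      rw [← pullCount_eq_pulls]; norm_cast; omega
    obtain ⟨σ, hσ⟩ := exists_pow_le_prod_of_deviation hT hp hd
    refine Set.mem_iUnion.2 ⟨(u, k, ⟨pullCount h u k - 1, by omega⟩, σ), ?_⟩
    simp only [E, g, l, Set.mem_ofPred_eq, hn]
    exact hσ
  have hE : ∀ i, (historyLaw A D t) (E i) ≤ ENNReal.ofReal (1 / T ^ 4) := by
    rintro ⟨u, k, n, σ⟩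
    have hg : Measurable (g u k n σ) := by fun_prop
    have hpos : ∀ x, 0 < g u k n σ x := fun x => Real.exp_pos _
    have hm := meas_ge_le_lintegral_div (μ := historyLaw A D t) (ε := ENNReal.ofReal (T ^ 4))
      (f := fun h => ENNReal.ofReal (∏ s, roundLikelihood u k (g u k n σ) (h s)))
      (measurable_prod_roundLikelihood u k hg t).ennreal_ofReal.aemeasurable
      (by simpa using by positivity) ENNReal.ofReal_ne_top
    rw [ENNReal.ofReal_div_of_pos (by positivity), ENNReal.ofReal_one]
    refine (measure_mono fun h hh => ?_).trans (hm.trans (ENNReal.div_le_div_right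
      (lintegral_prod_roundLikelihood_le A D u k hg hpos (lintegral_exp_le_one D u k _) t) _))
    exact ENNReal.ofReal_le_ofReal hh
  -- There are `U * K * T * 2 ≤ 2 * T ^ 3` events, each of probability at most `T ^ (-4)`.
  have hbound : (historyLaw A D t) {h | BadHistory T D h} ≤
      ENNReal.ofReal ((U * (K * (T * 2)) : ℕ) * (1 / T ^ 4)) := by
    refine (measure_mono hsub).trans ((measure_iUnion_fintype_le _ _).trans
      ((Finset.sum_le_sum fun i _ => hE i).trans (le_of_eq ?_)))
    rw [ENNReal.ofReal_mul (Nat.cast_nonneg _), ENNReal.ofReal_natCast]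
    simp [Fintype.card_prod]
  refine (ENNReal.toReal_mono ENNReal.ofReal_ne_top hbound).trans ?_
  rw [ENNReal.toReal_ofReal (by positivity)]
  have hU' : (U : ℝ) ≤ T := by exact_mod_cast hU
  have hK' : (K : ℝ) ≤ T := by exact_mod_cast hK
  push_cast
  rw [mul_one_div, div_le_div_iff₀ (by positivity) hT0]
  have : (U : ℝ) * K ≤ T * T := mul_le_mul hU' hK' (by positivity) hT0.le
  nlinarith [mul_le_mul_of_nonneg_right this (show 0 ≤ (T : ℝ) * 2 * T by positivity)]

end Concentration

/-! ### Existence of implementations -/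

section Existence

variable {U K : ℕ} {b : BudgetConstraint K}

theorem feasible_const (b : BudgetConstraint K) (k : Fin K) :
    b.Feasible (fun _ : Fin U => k) := by
  unfold BudgetConstraint.Feasible
  calc ∑ j ∈ Finset.univ.image (fun _ : Fin U => k), b.cost j ≤ ∑ j ∈ {k}, b.cost j :=
        Finset.sum_le_sum_of_subset (by intro j; simp +contextual)
    _ ≤ b.budget := by simpa using b.cost_le k

/-- No index is `⊥`, so one infinite term makes the sum `⊤`. -/
theorem ucbValue_eq_top {t : ℕ} (T : ℕ) {h : History U K t} {π : Matching U K}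
    (hπ : untriedCount h π ≠ 0) : ucbValue T h π = ⊤ := by
  obtain ⟨u, hu⟩ := Finset.card_ne_zero.1 hπ
  have hu : pullCount h u (π u) = 0 := by simpa using hu
  have htop : ucb T h u (π u) = ⊤ := by simp [ucb, hu]
  unfold ucbValue
  rw [← Finset.add_sum_erase _ _ (Finset.mem_univ u), htop]
  refine EReal.top_add_of_ne_bot (Finset.sum_induction _ (· ≠ ⊥)
    (fun x y hx hy => EReal.add_ne_bot_iff.2 ⟨hx, hy⟩) (by simp) fun v _ => ?_)
  unfold ucb
  split_ifs
  · exact EReal.coe_ne_bot _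
  · simp

/-- The two maximality conditions are compatible: maximize the untried count first and the value
second. A positive maximal count already gives value `⊤`; a zero one leaves all feasible matchings
in the second competition. -/
theorem exists_isOptimisticChoice (hK : 1 ≤ K) (T : ℕ) {t : ℕ} (h : History U K t) :
    ∃ π, IsOptimisticChoice b T h π := by
  obtain ⟨m, hm, hmax⟩ := Set.exists_max_image {π : Matching U K | b.Feasible π}
    (untriedCount h) (Set.toFinite _) ⟨_, feasible_const b ⟨0, hK⟩⟩
  obtain ⟨π, ⟨hπ, hπm⟩, hπmax⟩ := Set.exists_max_image
    {π : Matching U K | b.Feasible π ∧ untriedCount h π = untriedCount h m}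
    (ucbValue T h) (Set.toFinite _) ⟨m, hm, rfl⟩
  refine ⟨π, hπ, fun π' hπ' => ?_, fun π' hπ' => hπm ▸ hmax π' hπ'⟩
  by_cases h0 : untriedCount h π = 0
  · refine hπmax π' ⟨hπ', ?_⟩
    have := hmax π' hπ'
    omega
  · rw [ucbValue_eq_top T h0]
    exact le_top

theorem measurable_pullCount {t : ℕ} (u : Fin U) (k : Fin K) :
    Measurable fun h : History U K t => pullCount h u k := by
  simp only [pullCount, Finset.card_filter]
  exact Finset.measurable_sum _ fun s _ => Measurable.ite
    ((measurableSet_assigned u k).preimage (measurable_pi_apply s)) measurable_const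
    measurable_const

theorem measurable_ucb {t : ℕ} (T : ℕ) (u : Fin U) (k : Fin K) :
    Measurable fun h : History U K t => ucb T h u k := by
  unfold ucb
  refine Measurable.ite (measurableSet_lt measurable_const (measurable_pullCount u k))
    (Measurable.coe_real_ereal ((measurable_empMean u k).add ?_)) measurable_const
  simp_rw [pullCount_eq_pulls]
  exact (measurable_const.div (measurable_pulls u k)).sqrt

theorem measurableSet_isOptimisticChoice {t : ℕ} (T : ℕ) (π : Matching U K) :
    MeasurableSet {h : History U K t | IsOptimisticChoice b T h π} := by
  have hv : ∀ π : Matching U K, Measurable fun h : History U K t => ucbValue T h π := fun π =>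
    Finset.measurable_sum _ fun u _ => measurable_ucb T u (π u)
  have hc : ∀ π : Matching U K, Measurable fun h : History U K t => untriedCount h π := fun π => by
    simp only [untriedCount, Finset.card_filter]
    exact Finset.measurable_sum _ fun u _ => Measurable.ite
      (measurableSet_eq_fun (measurable_pullCount u (π u)) measurable_const) measurable_const
      measurable_const
  refine MeasurableSet.inter (MeasurableSet.const _) (MeasurableSet.inter ?_ ?_)
  · refine measurableSet_setOfPred.2 (Measurable.forall fun π' => ?_)
    exact Measurable.imp measurable_const (measurableSet_setOfPred.1 (measurableSet_le (hv π') (hv π)))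
  · refine measurableSet_setOfPred.2 (Measurable.forall fun π' => ?_)
    exact Measurable.imp measurable_const (measurableSet_setOfPred.1 (measurableSet_le (hc π') (hc π)))

/-- Ties are broken by the first optimistic choice in a fixed enumeration of the matchings, which is
a measurable rule. -/
theorem exists_measurable_isOptimisticChoice (b : BudgetConstraint K) (hK : 1 ≤ K) (T t : ℕ) :
    ∃ f : History U K t → Matching U K, Measurable f ∧ ∀ h, IsOptimisticChoice b T h (f h) := by
  classical
  have : Nonempty (Matching U K) := ⟨fun _ => ⟨0, hK⟩⟩
  obtain ⟨e, he⟩ := exists_surjective_nat (Matching U K)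
  have hp : ∀ h : History U K t, ∃ n, IsOptimisticChoice b T h (e n) := by
    intro h
    obtain ⟨π, hπ⟩ := exists_isOptimisticChoice (b := b) hK T h
    obtain ⟨n, rfl⟩ := he π
    exact ⟨n, hπ⟩
  exact ⟨fun h => e (Nat.find (hp h)), (measurable_of_countable e).comp
    (measurable_find hp fun n => measurableSet_isOptimisticChoice T (e n)),
    fun h => Nat.find_spec (hp h)⟩

theorem exists_isCUCB (b : BudgetConstraint K) (hK : 1 ≤ K) (T : ℕ) :
    ∃ A : Learner U b, IsCUCB T A := by
  choose f hf hopt using exists_measurable_isOptimisticChoice (U := U) b hK T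
  refine ⟨{ policy := fun t => Kernel.deterministic (f t) (hf t)
            isMarkov := fun t => inferInstance
            feasible := fun t h => ?_ }, fun t _ h => ?_⟩
  · rw [Kernel.deterministic_apply, ae_dirac_eq]
    exact (hopt t h).1
  · rw [Kernel.deterministic_apply, ae_dirac_eq]
    exact hopt t h

end Existence

/-! ### The regret of the algorithm -/

section UpperBound

variable {U K : ℕ} {b : BudgetConstraint K}

/-! ### Length of the exploration phase -/

theorem pulls_appendRound {t : ℕ} (u : Fin U) (k : Fin K) (x : History U K t × Round U K) :
    pulls u k (appendRound x) = pulls u k x.1 + if x.2.1 u = k then 1 else 0 :=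
  sum_appendRound (fun y : Round U K => if y.1 u = k then (1 : ℝ) else 0) x

/-- The number of pairs that have not been tried yet. -/
noncomputable def untriedPairs {t : ℕ} (h : History U K t) : ℝ :=
  ∑ u, ∑ k, if pulls u k h = 0 then 1 else 0

theorem measurable_untriedPairs {t : ℕ} :
    Measurable (untriedPairs : History U K t → ℝ) :=
  Finset.measurable_sum _ fun u _ => Finset.measurable_sum _ fun k _ =>
    Measurable.ite (measurableSet_eq_fun (measurable_pulls u k) measurable_const) measurable_const
      measurable_const

theorem untriedCount_eq {t : ℕ} (h : History U K t) (π : Matching U K) :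
    (untriedCount h π : ℝ) = ∑ u, if pulls u (π u) h = 0 then 1 else 0 := by
  simp only [untriedCount, pullCount_eq_zero_iff]
  simp

theorem untriedPairs_appendRound {t : ℕ} (x : History U K t × Round U K) :
    untriedPairs (appendRound x) = untriedPairs x.1 - untriedCount x.1 x.2.1 := by
  rw [untriedCount_eq, untriedPairs, untriedPairs, ← Finset.sum_sub_distrib]
  refine Finset.sum_congr rfl fun u _ => ?_
  have : ∀ k, (if pulls u k (appendRound x) = 0 then (1 : ℝ) else 0) =
      (if pulls u k x.1 = 0 then 1 else 0) -
        if x.2.1 u = k then (if pulls u k x.1 = 0 then 1 else 0) else 0 := by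
    intro k
    rw [pulls_appendRound]
    by_cases hk : x.2.1 u = k
    · have := pulls_nonneg u k x.1
      simp [hk, show pulls u k x.1 + 1 ≠ 0 by linarith]
    · simp [hk]
  simp_rw [this, Finset.sum_sub_distrib]
  simp

/-- The matching sending every user to arm `k` is feasible, so no arm has more untried users than an
optimistic choice serves. Summing over the arms gives the factor `K`. -/
theorem untriedPairs_le_mul {t T : ℕ} {h : History U K t} {π : Matching U K}
    (hπ : IsOptimisticChoice b T h π) : untriedPairs h ≤ K * untriedCount h π := by
  rw [untriedPairs, Finset.sum_comm]
  calc ∑ k, ∑ u, (if pulls u k h = 0 then (1 : ℝ) else 0)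
      ≤ ∑ _k : Fin K, (untriedCount h π : ℝ) := by
        refine Finset.sum_le_sum fun k _ => ?_
        have := hπ.2.2 (fun _ => k) (feasible_const b k)
        rw [← untriedCount_eq h (fun _ => k)]
        exact_mod_cast this
    _ = K * untriedCount h π := by simp

theorem ae_stepLaw_optimistic {A : Learner U b} {T t : ℕ} (hA : IsCUCB T A) (D : RewardModel U K)
    (ht : t < T) : ∀ᵐ x ∂(stepLaw A D t), IsOptimisticChoice b T x.1 x.2.1 := by
  refine ae_stepLaw_of_ae_ae A D t ?_ (Filter.Eventually.of_forall fun h => ?_)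
  · have : {x : History U K t × Round U K | IsOptimisticChoice b T x.1 x.2.1} =
        ⋃ π, ({x | IsOptimisticChoice b T x.1 π} ∩ {x | x.2.1 = π}) := by
      ext x; simp
    rw [this]
    refine MeasurableSet.iUnion fun π => MeasurableSet.inter
      ((measurableSet_isOptimisticChoice T π).preimage measurable_fst) ?_
    exact (measurable_fst.comp measurable_snd) (measurableSet_singleton π)
  · filter_upwards [hA t ht h] with π hπ
    exact Filter.Eventually.of_forall fun _ => hπ

theorem ae_untriedPairs_le {A : Learner U b} {T : ℕ} (hA : IsCUCB T A) (D : RewardModel U K)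
    (hK : 1 ≤ K) {t : ℕ} (ht : t ≤ T) :
    ∀ᵐ h ∂(historyLaw A D t), untriedPairs h ≤ U * K * (1 - 1 / K : ℝ) ^ t := by
  have hK' : (1 : ℝ) ≤ K := by exact_mod_cast hK
  induction t with
  | zero =>
    refine Filter.Eventually.of_forall fun h => ?_
    simp [untriedPairs, pulls]
  | succ t ih =>
    refine ae_historyLaw_succ A D t (measurableSet_le measurable_untriedPairs measurable_const) ?_
    filter_upwards [ae_stepLaw_fst A D t (ih (by omega)), ae_stepLaw_optimistic hA D ht]
      with x h1 h2
    rw [untriedPairs_appendRound]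
    have h3 := untriedPairs_le_mul h2
    have h4 : untriedPairs x.1 / K ≤ untriedCount x.1 x.2.1 := by
      rw [div_le_iff₀ (by linarith)]; linarith
    have h5 : (0 : ℝ) ≤ 1 - 1 / K := by
      rw [sub_nonneg, div_le_one (by linarith)]; exact hK'
    calc untriedPairs x.1 - untriedCount x.1 x.2.1 ≤ untriedPairs x.1 * (1 - 1 / K) := by
          rw [mul_one_sub, mul_one_div]; linarith
      _ ≤ U * K * (1 - 1 / K : ℝ) ^ t * (1 - 1 / K) := mul_le_mul_of_nonneg_right h1 h5
      _ = U * K * (1 - 1 / K : ℝ) ^ (t + 1) := by ring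

theorem pulls_pos_of_untriedPairs_lt {t : ℕ} {h : History U K t} (hh : untriedPairs h < 1)
    (u : Fin U) (k : Fin K) : 0 < pulls u k h := by
  refine lt_of_le_of_ne (pulls_nonneg u k h) fun h0 => ?_
  have h1 : (if pulls u k h = 0 then (1 : ℝ) else 0) ≤
      ∑ k, if pulls u k h = 0 then (1 : ℝ) else 0 :=
    Finset.single_le_sum (f := fun k => if pulls u k h = 0 then (1 : ℝ) else 0)
      (fun k _ => by positivity) (Finset.mem_univ k)
  have h2 : (∑ k, if pulls u k h = 0 then (1 : ℝ) else 0) ≤ untriedPairs h :=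
    Finset.single_le_sum (f := fun u => ∑ k, if pulls u k h = 0 then (1 : ℝ) else 0)
      (fun u _ => by positivity) (Finset.mem_univ u)
  rw [if_pos h0.symm] at h1
  linarith

/-- The power is at most `exp (-t / K) < T ^ (-2)`, while `U * K ≤ T ^ 2`. -/
theorem untriedPairs_bound_lt_one {T t : ℕ} (hT : 1 ≤ T) (hU : U ≤ T) (hK : 1 ≤ K) (hKT : K ≤ T)
    (ht : 2 * K * Real.log T < t) : U * K * (1 - 1 / K : ℝ) ^ t < 1 := by
  have hT0 : (0 : ℝ) < T := by exact_mod_cast hT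
  have hK' : (1 : ℝ) ≤ K := by exact_mod_cast hK
  have hU' : (U : ℝ) ≤ T := by exact_mod_cast hU
  have hKT' : (K : ℝ) ≤ T := by exact_mod_cast hKT
  have h5 : (0 : ℝ) ≤ 1 - 1 / K := by
    rw [sub_nonneg, div_le_one (by linarith)]; exact hK'
  have h1 : (1 - 1 / K : ℝ) ^ t ≤ Real.exp (-(t / K)) := by
    calc (1 - 1 / K : ℝ) ^ t ≤ Real.exp (-(1 / K)) ^ t :=
          pow_le_pow_left₀ h5 (Real.one_sub_le_exp_neg _) t
      _ = Real.exp (-(t / K)) := by rw [← Real.exp_nat_mul]; congr 1; ring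
  have h2 : Real.exp (-(t / K)) < 1 / (T : ℝ) ^ 2 := by
    have : 1 / (T : ℝ) ^ 2 = Real.exp (-(2 * Real.log T)) := by
      rw [Real.exp_neg, mul_comm, Real.exp_mul, Real.exp_log hT0, one_div]; norm_cast
    rw [this, Real.exp_lt_exp, neg_lt_neg_iff, lt_div_iff₀ (by linarith)]
    linarith
  have h3 : (U : ℝ) * K ≤ T ^ 2 := by
    rw [sq]; exact mul_le_mul hU' hKT' (by linarith) hT0.le
  calc U * K * (1 - 1 / K : ℝ) ^ t ≤ T ^ 2 * (1 - 1 / K : ℝ) ^ t :=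
        mul_le_mul_of_nonneg_right h3 (by positivity)
    _ < T ^ 2 * (1 / (T : ℝ) ^ 2) := mul_lt_mul_of_pos_left (h1.trans_lt h2) (by positivity)
    _ = 1 := by field_simp

/-! ### Optimism and the width potential -/

theorem ereal_coe_sum {ι : Type*} (s : Finset ι) (f : ι → ℝ) :
    ((∑ i ∈ s, f i : ℝ) : EReal) = ∑ i ∈ s, (f i : EReal) := by
  classical
  induction s using Finset.induction_on with
  | empty => simp
  | insert i s hi ih => rw [Finset.sum_insert hi, Finset.sum_insert hi, EReal.coe_add, ih]

theorem optValue_le_of_forall (D : RewardModel U K) (hK : 1 ≤ K) {c : ℝ}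
    (h : ∀ π, b.Feasible π → D.value π ≤ c) : D.optValue b ≤ c := by
  have : Nonempty {π : Matching U K // b.Feasible π} :=
    ⟨⟨fun _ => ⟨0, hK⟩, feasible_const b _⟩⟩
  exact ciSup_le fun π => h π.1 π.2

theorem optValue_sub_value_le (D : RewardModel U K) (hK : 1 ≤ K) (π : Matching U K) :
    D.optValue b - D.value π ≤ U := by
  have := optValue_le_of_forall (b := b) D hK fun π _ => D.value_le π
  have := D.value_nonneg π
  linarith

/-- Optimism: when all pairs have been tried and all empirical means are accurate, the loss of an
optimistic choice is at most twice its total confidence width. -/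
theorem optValue_sub_value_le_width (D : RewardModel U K) (hK : 1 ≤ K) {T t : ℕ}
    {h : History U K t} {π : Matching U K} (hπ : IsOptimisticChoice b T h π)
    (hpos : ∀ u k, 0 < pulls u k h) (hgood : ¬ BadHistory T D h) :
    D.optValue b - D.value π ≤ ∑ u, 2 * Real.sqrt (2 * Real.log T / pulls u (π u) h) := by
  let P : Fin U → Fin K → ℝ := fun u k =>
    empMean h u k + Real.sqrt (2 * Real.log T / pulls u k h)
  have hucb : ∀ π', ucbValue T h π' = ((∑ u, P u (π' u) : ℝ) : EReal) := by
    intro π'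
    rw [ereal_coe_sum]
    refine Finset.sum_congr rfl fun u _ => ?_
    rw [ucb, if_pos ((pullCount_pos_iff h u _).2 (hpos u _)), pullCount_eq_pulls]
  have hdev : ∀ u k, |empMean h u k - D.mean u k| ≤
      Real.sqrt (2 * Real.log T / pulls u k h) := fun u k => by
    by_contra hc
    exact hgood ⟨u, k, hpos u k, not_le.1 hc⟩
  have hopt : D.optValue b ≤ ∑ u, P u (π u) := by
    refine optValue_le_of_forall D hK fun π' hπ' => ?_
    have := hπ.2.1 π' hπ'
    rw [hucb, hucb, EReal.coe_le_coe_iff] at this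
    refine le_trans (Finset.sum_le_sum fun u _ => ?_) this
    have := (abs_le.1 (hdev u (π' u))).1
    simp only [P]
    linarith
  rw [sub_le_iff_le_add, RewardModel.value, ← Finset.sum_add_distrib]
  refine hopt.trans (Finset.sum_le_sum fun u _ => ?_)
  have := (abs_le.1 (hdev u (π u))).2
  simp only [P]
  linarith

/-- The potential that pays for the confidence widths. -/
noncomputable def widthPotential {t : ℕ} (h : History U K t) : ℝ :=
  ∑ u, ∑ k, Real.sqrt (pulls u k h)

theorem measurable_widthPotential {t : ℕ} : Measurable (widthPotential : History U K t → ℝ) :=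
  Finset.measurable_sum _ fun u _ => Finset.measurable_sum _ fun k _ => (measurable_pulls u k).sqrt

theorem widthPotential_nonneg {t : ℕ} (h : History U K t) : 0 ≤ widthPotential h :=
  Finset.sum_nonneg fun _ _ => Finset.sum_nonneg fun _ _ => Real.sqrt_nonneg _

/-- Cauchy–Schwarz over the arms of each user, whose pull counts sum to `t`. -/
theorem widthPotential_le {t : ℕ} (h : History U K t) :
    widthPotential h ≤ U * Real.sqrt (K * t) := by
  calc widthPotential h ≤ ∑ _u : Fin U, Real.sqrt (K * t) := by
        refine Finset.sum_le_sum fun u _ => Real.le_sqrt_of_sq_le ?_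
        refine sq_sum_le_card_mul_sum_sq.trans (le_of_eq ?_)
        simp_rw [Real.sq_sqrt (pulls_nonneg u _ h), sum_pulls]
        simp
    _ = U * Real.sqrt (K * t) := by simp

theorem widthPotential_appendRound {t : ℕ} (x : History U K t × Round U K) :
    widthPotential (appendRound x) - widthPotential x.1 =
      ∑ u, (Real.sqrt (pulls u (x.2.1 u) x.1 + 1) - Real.sqrt (pulls u (x.2.1 u) x.1)) := by
  rw [widthPotential, widthPotential, ← Finset.sum_sub_distrib]
  refine Finset.sum_congr rfl fun u _ => ?_
  rw [← Finset.sum_sub_distrib, Finset.sum_eq_single (x.2.1 u)]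
  · simp [pulls_appendRound]
  · intro k _ hk
    simp [pulls_appendRound, hk.symm]
  · simp

theorem one_le_pulls {t : ℕ} {h : History U K t} {u : Fin U} {k : Fin K} (hp : 0 < pulls u k h) :
    1 ≤ pulls u k h := by
  rw [← pullCount_eq_pulls] at hp ⊢
  exact_mod_cast hp

/-- The increment is `1 / (√(n + 1) + √n)`, and `√(n + 1) ≤ 3 / 2 * √n` for `n ≥ 1` bounds the
denominator by `5 / 2 * √n`. -/
theorem width_le_potential_increment {n a : ℝ} (hn : 1 ≤ n) :
    2 * Real.sqrt (a / n) ≤ 5 * Real.sqrt a * (Real.sqrt (n + 1) - Real.sqrt n) := by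
  have hs := Real.one_le_sqrt.2 hn
  have h1 := Real.sq_sqrt (show 0 ≤ n by linarith)
  have h2 := Real.sq_sqrt (show 0 ≤ n + 1 by linarith)
  have h0 := Real.sqrt_nonneg (n + 1)
  have h3 : √(n + 1) ≤ 3 / 2 * √n := by
    refine Real.sqrt_le_iff.2 ⟨by positivity, ?_⟩
    nlinarith
  have h4 : 2 / √n ≤ 5 * (√(n + 1) - √n) := by
    rw [div_le_iff₀ (by linarith)]
    have h5 : (√(n + 1) - √n) * (√(n + 1) + √n) = 1 := by linarith
    have h6 : 0 ≤ √(n + 1) - √n := sub_nonneg.2 (Real.sqrt_le_sqrt (by linarith))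
    nlinarith [mul_nonneg h6 (sub_nonneg.2 h3)]
  rw [Real.sqrt_div' _ (by linarith)]
  calc 2 * (√a / √n) = √a * (2 / √n) := by ring
    _ ≤ √a * (5 * (√(n + 1) - √n)) := mul_le_mul_of_nonneg_left h4 (Real.sqrt_nonneg a)
    _ = _ := by ring

/-- Exploration rounds and rounds after a bad history are charged the maximal loss `U`; in all
others optimism and the potential apply. -/
theorem ae_regret_increment_le {A : Learner U b} {T t : ℕ} (hA : IsCUCB T A) (D : RewardModel U K)
    (hT : 1 ≤ T) (hU : U ≤ T) (hK : 1 ≤ K) (hKT : K ≤ T) (ht : t < T) :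
    ∀ᵐ x ∂(stepLaw A D t), D.optValue b - D.value x.2.1 ≤
      5 * Real.sqrt (2 * Real.log T) * (widthPotential (appendRound x) - widthPotential x.1) +
      (Set.indicator {h | BadHistory T D h} (fun _ => (U : ℝ)) x.1 +
        if (t : ℝ) ≤ 2 * K * Real.log T then (U : ℝ) else 0) := by
  filter_upwards [ae_stepLaw_fst A D t (ae_untriedPairs_le hA D hK ht.le),
    ae_stepLaw_optimistic hA D ht] with x h1 h2
  have hle := optValue_sub_value_le (b := b) D hK x.2.1
  have hinc : 0 ≤ widthPotential (appendRound x) - widthPotential x.1 := by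
    rw [widthPotential_appendRound]
    exact Finset.sum_nonneg fun u _ => sub_nonneg.2 (Real.sqrt_le_sqrt (by linarith))
  have hinc' := mul_nonneg (mul_nonneg (by norm_num : (0 : ℝ) ≤ 5)
    (Real.sqrt_nonneg (2 * Real.log T))) hinc
  have hU0 : (0 : ℝ) ≤ U := Nat.cast_nonneg U
  have hind : 0 ≤ Set.indicator {h | BadHistory T D h} (fun _ => (U : ℝ)) x.1 :=
    Set.indicator_nonneg (fun _ _ => hU0) _
  by_cases hexp : (t : ℝ) ≤ 2 * K * Real.log T
  · rw [if_pos hexp]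
    linarith
  rw [if_neg hexp]
  by_cases hbad : BadHistory T D x.1
  · rw [Set.indicator_of_mem (s := {h | BadHistory T D h}) hbad]
    linarith
  have hpos := pulls_pos_of_untriedPairs_lt
    (h1.trans_lt (untriedPairs_bound_lt_one hT hU hK hKT (not_le.1 hexp)))
  have hw := optValue_sub_value_le_width D hK h2 hpos hbad
  refine (hw.trans ?_).trans (le_add_of_nonneg_right (by simpa using hind))
  rw [widthPotential_appendRound, Finset.mul_sum]
  exact Finset.sum_le_sum fun u _ =>
    width_le_potential_increment (one_le_pulls (hpos u (x.2.1 u)))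

/-- Subtracting the potential telescopes the confidence widths, so each round adds only its
exploration charge and `U` times the probability of a bad history. -/
theorem integral_regret_sub_potential_le {A : Learner U b} {T t : ℕ} (hA : IsCUCB T A)
    (D : RewardModel U K) (hT : 1 ≤ T) (hU : U ≤ T) (hK : 1 ≤ K) (hKT : K ≤ T) (ht : t ≤ T) :
    ∫ h, (∑ s, (D.optValue b - D.value (h s).1) -
      5 * Real.sqrt (2 * Real.log T) * widthPotential h) ∂(historyLaw A D t) ≤
    ∑ s ∈ Finset.range t, (U * (2 / T) + if (s : ℝ) ≤ 2 * K * Real.log T then (U : ℝ) else 0) := by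
  have hT0 : (0 : ℝ) < T := by exact_mod_cast hT
  have hm : ∀ t, Measurable fun h : History U K t => ∑ s, (D.optValue b - D.value (h s).1) -
      5 * Real.sqrt (2 * Real.log T) * widthPotential h := fun t =>
    (measurable_sum_history (measurable_fst_round fun π => D.optValue b - D.value π)).sub
      (measurable_widthPotential.const_mul _)
  have hi : ∀ t, Integrable (fun h : History U K t => ∑ s, (D.optValue b - D.value (h s).1) -
      5 * Real.sqrt (2 * Real.log T) * widthPotential h) (historyLaw A D t) := fun t =>
    (integrable_sum_matching A D fun π => D.optValue b - D.value π).sub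
      ((integrable_of_bounded A D measurable_widthPotential fun h => by
        rw [abs_of_nonneg (widthPotential_nonneg h)]; exact widthPotential_le h).const_mul _)
  induction t with
  | zero => simp [widthPotential, pulls]
  | succ t ih =>
    rw [Finset.sum_range_succ]
    have hbm := measurableSet_badHistory (t := t) T D
    have hbi : Integrable (Set.indicator {h | BadHistory T D h} fun _ => (U : ℝ))
      (historyLaw A D t) := (integrable_const _).indicator hbm
    have i1 : Integrable (fun h => Set.indicator {h | BadHistory T D h} (fun _ => (U : ℝ)) h +
        if (t : ℝ) ≤ 2 * K * Real.log T then (U : ℝ) else 0) (historyLaw A D t) :=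
      hbi.add (integrable_const _)
    refine (integral_historyLaw_succ_le A D t (hm (t + 1)) (G := fun h =>
      (∑ s, (D.optValue b - D.value (h s).1) -
        5 * Real.sqrt (2 * Real.log T) * widthPotential h) +
      (Set.indicator {h | BadHistory T D h} (fun _ => (U : ℝ)) h +
        if (t : ℝ) ≤ 2 * K * Real.log T then (U : ℝ) else 0))
      ((hm t).add ((measurable_const.indicator hbm).add measurable_const)) (hi (t + 1))
      ((hi t).add i1) ?_).trans ?_
    · filter_upwards [ae_regret_increment_le hA D hT hU hK hKT ht] with x hx
      rw [sum_appendRound fun y : Round U K => D.optValue b - D.value y.1]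
      linarith
    · rw [integral_add (hi t) i1, integral_add hbi (integrable_const _),
        integral_indicator hbm, setIntegral_const]
      refine add_le_add (ih (by omega)) (add_le_add ?_ (by simp))
      rw [smul_eq_mul, mul_comm]
      exact mul_le_mul_of_nonneg_left (measure_badHistory_le A D hT (by omega) hU hKT)
        (Nat.cast_nonneg U)

/-! ### Assembling the upper bound -/

theorem sum_range_ite_le {c : ℝ} (hc : 0 ≤ c) (a : ℝ) (ha : 0 ≤ a) (T : ℕ) :
    ∑ s ∈ Finset.range T, (if (s : ℝ) ≤ a then c else 0) ≤ c * (a + 1) := by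
  rw [← Finset.sum_filter, Finset.sum_const, nsmul_eq_mul, mul_comm]
  refine mul_le_mul_of_nonneg_left ?_ hc
  have : ((Finset.range T).filter fun s : ℕ => (s : ℝ) ≤ a) ⊆ Finset.range (⌊a⌋₊ + 1) := by
    intro s hs
    rw [Finset.mem_range, Nat.lt_succ_iff]
    exact Nat.le_floor (Finset.mem_filter.1 hs).2
  have h2 : ((((Finset.range T).filter fun s : ℕ => (s : ℝ) ≤ a).card : ℕ) : ℝ) ≤
      ((⌊a⌋₊ + 1 : ℕ) : ℝ) := by
    exact_mod_cast (Finset.card_le_card this).trans (by simp)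
  refine h2.trans ?_
  push_cast
  linarith [Nat.floor_le ha]

theorem regret_le_of_isCUCB {A : Learner U b} {T : ℕ} (hA : IsCUCB T A) (D : RewardModel U K)
    (hT : 1 ≤ T) (hU : U ≤ T) (hK : 1 ≤ K) (hKT : K ≤ T) :
    regret T A D ≤ U * (2 * K * Real.log T + 3) +
      5 * Real.sqrt (2 * Real.log T) * (U * Real.sqrt (K * T)) := by
  have hT0 : (0 : ℝ) < T := by exact_mod_cast hT
  have hlog : 0 ≤ Real.log T := Real.log_nonneg (by exact_mod_cast hT)
  have hwi : Integrable (fun h : History U K T => 5 * Real.sqrt (2 * Real.log T) *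
      widthPotential h) (historyLaw A D T) :=
    (integrable_of_bounded A D measurable_widthPotential fun h => by
      rw [abs_of_nonneg (widthPotential_nonneg h)]; exact widthPotential_le h).const_mul _
  have h1 := integral_regret_sub_potential_le hA D hT hU hK hKT le_rfl
  rw [integral_sub (integrable_sum_matching A D fun π => D.optValue b - D.value π) hwi,
    ← regret_eq, Finset.sum_add_distrib] at h1
  have h2 := sum_range_ite_le (Nat.cast_nonneg U) (2 * K * Real.log T) (by positivity) T
  have h3 : ∑ _s ∈ Finset.range T, (U : ℝ) * (2 / T) = 2 * U := by
    rw [Finset.sum_const, Finset.card_range, nsmul_eq_mul]; field_simp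
  have h4 : ∫ h : History U K T, 5 * Real.sqrt (2 * Real.log T) * widthPotential h
      ∂(historyLaw A D T) ≤ 5 * Real.sqrt (2 * Real.log T) * (U * Real.sqrt (K * T)) := by
    refine (integral_mono hwi (integrable_const _) fun h => mul_le_mul_of_nonneg_left
      (widthPotential_le h) (by positivity)).trans (by simp)
  rw [h3] at h1
  linarith

theorem regret_le_mul (A : Learner U b) (D : RewardModel U K) (hK : 1 ≤ K) (T : ℕ) :
    regret T A D ≤ T * U := by
  rw [regret_eq]
  refine (integral_mono (integrable_sum_matching A D fun π => D.optValue b - D.value π)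
    (integrable_const ((T : ℝ) * U)) fun h => ?_).trans (by simp)
  exact (Finset.sum_le_sum fun t _ => optValue_sub_value_le D hK (h t).1).trans (by simp)

theorem regret_le_zero_of_single_arm (A : Learner U b) (D : RewardModel U K) (hK : K = 1) (T : ℕ) :
    regret T A D ≤ 0 := by
  subst hK
  rw [regret_eq]
  refine integral_nonpos fun h => Finset.sum_nonpos fun t _ => sub_nonpos.2 ?_
  exact optValue_le_of_forall D le_rfl fun π _ => le_of_eq (by rw [Subsingleton.elim π])

theorem regret_le_sqrt {A : Learner U b} {T : ℕ} (hA : IsCUCB T A) (D : RewardModel U K)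
    (hU1 : 1 ≤ U) (hU : U ≤ T) (hK : 1 ≤ K) (hKT : K ≤ T) :
    regret T A D ≤ 13 * (U * Real.sqrt (K * T * Real.log T)) := by
  -- For `T = 1` the right-hand side vanishes because `log T = 0`, but then `K = 1` and there is
  -- nothing to lose.
  rcases Nat.lt_or_ge T 2 with hT | hT
  · refine (regret_le_zero_of_single_arm A D (by omega) T).trans (by positivity)
  have hT' : (2 : ℝ) ≤ T := by exact_mod_cast hT
  have hK' : (1 : ℝ) ≤ K := by exact_mod_cast hK
  have hU0 : (0 : ℝ) ≤ U := Nat.cast_nonneg U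
  have hlog : 1 / 2 ≤ Real.log T := by
    have := Real.log_le_log (by norm_num) hT'
    linarith [Real.log_two_gt_d9]
  rcases le_total (T : ℝ) (K * Real.log T) with h | h
  · have h1 : (T : ℝ) ≤ √(K * T * Real.log T) :=
      Real.le_sqrt_of_sq_le (by nlinarith)
    have h2 := mul_le_mul_of_nonneg_left h1 hU0
    have := regret_le_mul A D hK T
    have h3 : 0 ≤ U * √(K * T * Real.log T) := by positivity
    linarith
  · have h1 : K * Real.log T ≤ √(K * T * Real.log T) := by
      refine Real.le_sqrt_of_sq_le ?_
      have := mul_le_mul_of_nonneg_left h (show 0 ≤ K * Real.log T by positivity)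
      linarith
    have h2 : 1 ≤ √(K * T * Real.log T) := by
      rw [Real.one_le_sqrt]
      have h3 : 1 * 2 ≤ (K : ℝ) * T := mul_le_mul hK' hT' (by norm_num) (by linarith)
      nlinarith
    -- Here `√2 ≤ 8 / 5`, so the width term contributes `5 * 8 / 5 = 8`; with `2` from exploration
    -- and `3` from the additive constant the total is `13`.
    have h3 : √(2 * Real.log T) * √(K * T) ≤ 8 / 5 * √(K * T * Real.log T) := by
      rw [← Real.sqrt_mul (by positivity),
        show 2 * Real.log T * (K * T) = 2 * (K * T * Real.log T) by ring,
        Real.sqrt_mul (by norm_num)]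
      refine mul_le_mul_of_nonneg_right ?_ (Real.sqrt_nonneg _)
      rw [Real.sqrt_le_left (by norm_num)]
      norm_num
    have h4 := regret_le_of_isCUCB hA D (by omega) hU hK hKT
    have h5 := mul_le_mul_of_nonneg_left h1 hU0
    have h6 := mul_le_mul_of_nonneg_left h2 hU0
    have h7 := mul_le_mul_of_nonneg_left h3 hU0
    linarith

end UpperBound

theorem mainTheorem11 :
    (∃ C : ℝ, 0 < C ∧ ∀ U K T : ℕ, 1 ≤ U → 1 ≤ K → U ≤ T → K ≤ T → ∀ b : BudgetConstraint K,
      (∃ A : Learner U b, IsCUCB T A) ∧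
      ∀ A : Learner U b, IsCUCB T A → ∀ D : RewardModel U K,
        regret T A D ≤ C * (U * Real.sqrt (K * T * Real.log T))) ∧
    (∃ c : ℝ, 0 < c ∧ ∀ U K T : ℕ, 1 ≤ U → 2 ≤ K → U ≤ T → K ≤ T → ∃ b : BudgetConstraint K,
      ∀ A : Learner U b, ∃ D : RewardModel U K,
        c * (U * Real.sqrt (K * T)) ≤ regret T A D) := by
  refine ⟨⟨13, by norm_num, fun U K T hU hK hUT hKT b => ⟨exists_isCUCB b hK T,
    fun A hA D => regret_le_sqrt hA D hU hUT hK hKT⟩⟩, ⟨1 / 64, by norm_num,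
    fun U K T _ hK _ hKT => ⟨freeConstraint K, fun A => exists_regret_ge hK hKT A⟩⟩⟩
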